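/- A planar convex body is a nonempty compact convex set $K\subset\mathbb{R}^2$ (possibly with empty interior). Let $D(K)$ be its diameter; $w(K)$ its width, the minimum over all directions of the distance between the two supporting lines of $K$ orthogonal to that direction; $r(K)$ its inradius, the largest radius $\rho\ge 0$ of a disk contained in $K$; and $R(K)$ its circumradius, the radius of the smallest disk containing $K$. \textbf{Theorem.} (a) For every planar convex body $K$ with at least two points, \[ w(K)\;\le\; r(K)\,F(K),\qquad F(K):=1+\frac{2\sqrt2\,R(K)}{D(K)}\sqrt{1+\sqrt{1-\Bigl(\frac{D(K)}{2R(K)}\Bigr)^2}} . \] Moreover $F(K)\le 3$, so that this inequality strengthens the planar Steinhagen inequality $w(K)\le 3\,r(K)$, which is thereby recovered. (b) Every general sailing boat is a planar convex body with at least two points for which equality holds, $w(K)=r(K)\,F(K)$. Here general sailing boats are defined as follows. Let $I$ be a nondegenerate isosceles triangle whose angle $\gamma$ at the apex $p$ (the common endpoint of the two sides of equal length) lies in $[\pi/3,\pi/2]$, let $B$ be the disk, with center $o$ and radius $R$, bounded by the circle through the three vertices of $I$, and let $c$ be the incenter of $I$. The concentric sailing boat of $I$ is \[ S^{\circledcirc}:=\Bigl(o+\frac{R}{\|p-c\|}\,(I-c)\Bigr)\cap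 B . \] For every $r$ with $r(I)\le r\le r(S^{\circledcirc})$ the set \[ \Bigl(p+\frac{r}{r(I)}\,(I-p)\Bigr)\cap B \] is a general sailing boat. -/

import Mathlib

noncomputable section

/-- The Euclidean plane. -/
abbrev Plane : Type := EuclideanSpace ℝ (Fin 2)

/-- Convex bodies of the plane: compact convex (nonempty) sets, possibly without interior points. -/
structure IsConvexBody (K : Set Plane) : Prop where
  isCompact : IsCompact K
  convex : Convex ℝ K
  nonempty : K.Nonempty

/-- The breadth of `K` in the direction `u` (a unit vector): the distance between the two
supporting lines of `K` orthogonal to `u`. -/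
def breadth (K : Set Plane) (u : Plane) : ℝ :=
  sSup ((fun x : Plane => inner ℝ u x) '' K) - sInf ((fun x : Plane => inner ℝ u x) '' K)

/-- The (minimal) width: the smallest breadth over all directions. -/
def minWidth (K : Set Plane) : ℝ :=
  sInf (breadth K '' Metric.sphere (0 : Plane) 1)

/-- The inradius: the largest radius of a disk (possibly of radius `0`) contained in `K`. -/
def inradius (K : Set Plane) : ℝ :=
  sSup {ρ : ℝ | 0 ≤ ρ ∧ ∃ c : Plane, Metric.closedBall c ρ ⊆ K}

/-- The circumradius: the smallest radius of a disk containing `K`. -/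
def circumradius (K : Set Plane) : ℝ :=
  sInf {ρ : ℝ | 0 ≤ ρ ∧ ∃ c : Plane, K ⊆ Metric.closedBall c ρ}

/-- The factor `1 + (2√2 R / D) √(1 + √(1 - (D / 2R)²))`, where `R` and `D` are the circumradius
and the diameter of `K`. -/
def boatFactor (K : Set Plane) : ℝ :=
  1 + 2 * √2 * circumradius K / Metric.diam K *
    √(1 + √(1 - (Metric.diam K / (2 * circumradius K)) ^ 2))

/-- The triangle (as a full set) with vertices `p₁`, `p₂`, `p₃`. -/
def triangle (p₁ p₂ p₃ : Plane) : Set Plane := convexHull ℝ {p₁, p₂, p₃}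

/-- `p₁ p₂ p₃` is a nondegenerate isosceles triangle with apex `p₃`, inscribed in the circle with
center `o` and radius `R`, whose angle at the apex lies in `[π/3, π/2]`. -/
structure IsBoatTriangle (o : Plane) (R : ℝ) (p₁ p₂ p₃ : Plane) : Prop where
  affineIndependent : AffineIndependent ℝ ![p₁, p₂, p₃]
  mem_sphere₁ : p₁ ∈ Metric.sphere o R
  mem_sphere₂ : p₂ ∈ Metric.sphere o R
  mem_sphere₃ : p₃ ∈ Metric.sphere o R
  isosceles : dist p₁ p₃ = dist p₂ p₃
  le_angle : Real.pi / 3 ≤ EuclideanGeometry.angle p₁ p₃ p₂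
  angle_le : EuclideanGeometry.angle p₁ p₃ p₂ ≤ Real.pi / 2

/-- The concentric sailing boat of the triangle: if `c` is its incenter, the triangle is moved and
rescaled so that its incenter becomes `o` and its apex gets on the circle with center `o` and
radius `R`, and is then intersected with the disk bounded by that circle. -/
def concentricBoat (o : Plane) (R : ℝ) (p₁ p₂ p₃ c : Plane) : Set Plane :=
  ((fun x : Plane => o + (R / dist p₃ c) • (x - c)) '' triangle p₁ p₂ p₃) ∩ Metric.closedBall o R

/-- The general sailing boat of inradius `r`: the triangle is rescaled about its apex `p₃` to a
triangle of inradius `r`, and is then intersected with the disk with center `o` and radius `R`. -/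
def boat (o : Plane) (R : ℝ) (p₁ p₂ p₃ : Plane) (r : ℝ) : Set Plane :=
  (AffineMap.homothety p₃ (r / inradius (triangle p₁ p₂ p₃)) '' triangle p₁ p₂ p₃) ∩
    Metric.closedBall o R

/-- The general sailing boats: here `r` ranges from the inradius of the isosceles triangle
to the inradius of the concentric sailing boat, and `c` is the incenter of the triangle. -/
def IsSailingBoat (S : Set Plane) : Prop :=
  ∃ (o : Plane) (R : ℝ) (p₁ p₂ p₃ c : Plane) (r : ℝ),
    IsBoatTriangle o R p₁ p₂ p₃ ∧
    Metric.closedBall c (inradius (triangle p₁ p₂ p₃)) ⊆ triangle p₁ p₂ p₃ ∧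
    inradius (triangle p₁ p₂ p₃) ≤ r ∧
    r ≤ inradius (concentricBoat o R p₁ p₂ p₃ c) ∧
    S = boat o R p₁ p₂ p₃ r

end

noncomputable section

open InnerProductGeometry Filter Topology

/-! ### Coordinates in the plane -/

/-! Inequality. Write r, D, R for the inradius, diameter and circumradius, F = 1 + s, and let γ ≤
π/2 be the angle with sin γ = D/2R. For C = cos γ the formula for F becomes s²(1 - C) = 2, that is,
sin(γ/2) = 1/s (`exists_boatFactor_eq`). Jung's theorem (`three_mul_circumradius_sq_le`) gives C ≤
1/2, hence s ≤ 2 and F ≤ 3.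

Put the center of a largest inscribed disk at the origin. By maximality 0 is in the convex hull of
the contact normals (`zero_mem_convexHull_contact_normals`). Two opposite normals give w ≤ 2r.
Otherwise three normals surround 0, and consecutive ones span three disjoint open cones. If w > r(1
+ s), each cone contains a point q of K at distance more than rs from the origin
(`cross_pos_of_inner_lt`). The two ends x, y of a diameter miss one of the cones. From the q in that
cone, the segments to x and y leave the cone inside the supporting half-planes, so they meet the
disk (`exists_mem_segment_norm_le`), and the angle θ = xqy is less than 2 arcsin(1/s) = γ. As xy is
a longest side and θ is acute, the triangle xqy is not obtuse, so a disk containing it has radius at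
least D/(2 sin θ) > D/(2 sin γ) = R, a contradiction (`diam_sq_lt_of_lt_cos_angle`).

Equality. Let γ now be the apex angle, a = sin(γ/2) and b = cos(γ/2). One-sided estimates suffice
for a boat S: its inradius is at most r, `boatFactor S` is at most 1 + 1/a, and its width is at
least r(1 + 1/a), the height of the rescaled triangle (`le_minWidth_boat`). So w(S) ≥ r(S) F(S), and
the inequality already proved is the converse. -/

lemma Plane.inner_eq (x y : Plane) : inner ℝ x y = x 0 * y 0 + x 1 * y 1 := by
  simp [PiLp.inner_apply, Fin.sum_univ_two]; ring

lemma Plane.norm_sq_eq (x : Plane) : ‖x‖ ^ 2 = x 0 ^ 2 + x 1 ^ 2 := by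
  simp [EuclideanSpace.norm_sq_eq, Fin.sum_univ_two]

/-- The cross product of two plane vectors. -/
def cross (x y : Plane) : ℝ := x 0 * y 1 - x 1 * y 0

lemma cross_swap (x y : Plane) : cross y x = -cross x y := by simp only [cross]; ring

lemma cross_add_smul (u q y : Plane) (a b : ℝ) :
    cross u (a • q + b • y) = a * cross u q + b * cross u y := by
  simp [cross]; ring

lemma norm_sq_eq_inner_add_cross {u : Plane} (hu : ‖u‖ = 1) (z : Plane) :
    ‖z‖ ^ 2 = inner ℝ u z ^ 2 + cross u z ^ 2 := by
  have h := Plane.norm_sq_eq u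
  rw [hu] at h
  rw [Plane.norm_sq_eq, Plane.inner_eq, cross]
  linear_combination (z 0 ^ 2 + z 1 ^ 2) * h

lemma cross_eq_of_norm_eq_one {u : Plane} (hu : ‖u‖ = 1) (v z : Plane) :
    cross v z = inner ℝ u z * cross v u + cross u z * inner ℝ u v := by
  have h := Plane.norm_sq_eq u
  rw [hu] at h
  simp only [Plane.inner_eq, cross]
  linear_combination (v 0 * z 1 - v 1 * z 0) * h

/-! ### Segments leaving a cone between two contact normals. -/

lemma inner_combination_le {u q y : Plane} {a b r : ℝ} (ha : 0 ≤ a) (hb : 0 ≤ b)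
    (hab : a + b = 1) (hq : inner ℝ u q ≤ r) (hy : inner ℝ u y ≤ r) :
    inner ℝ u (a • q + b • y) ≤ r := by
  rw [inner_add_right, inner_smul_right, inner_smul_right]
  have : a * r + b * r = r := by rw [← add_mul, hab, one_mul]
  linarith [mul_le_mul_of_nonneg_left hq ha, mul_le_mul_of_nonneg_left hy hb]

/-- The segment from a point `q` of the cone spanned by `v`, `u` to a point beyond the ray
spanned by `u` crosses that ray. -/
lemma exists_mem_segment_norm_le_of_cross {σ r : ℝ} {u v q y : Plane} (hu : ‖u‖ = 1)
    (huv : 0 < σ * cross v u) (hq₁ : 0 ≤ σ * cross v q) (hq₂ : σ * cross u q ≤ 0)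
    (hy₁ : 0 ≤ σ * cross v y) (hy₂ : 0 ≤ σ * cross u y)
    (hqr : inner ℝ u q ≤ r) (hyr : inner ℝ u y ≤ r) :
    ∃ z ∈ segment ℝ q y, ‖z‖ ≤ r := by
  -- On the ray spanned by `u` the norm is the inner product with `u`, so it is enough to find the
  -- point where the segment crosses that ray.
  have key : ∀ z : Plane, cross u z = 0 → 0 ≤ σ * cross v z → inner ℝ u z ≤ r → ‖z‖ ≤ r := by
    intro z h0 h1 h2
    have h3 := cross_eq_of_norm_eq_one hu v z
    have h4 := norm_sq_eq_inner_add_cross hu z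
    rw [h0] at h3 h4
    have h5 : 0 ≤ inner ℝ u z := by
      by_contra h
      rw [h3] at h1
      nlinarith [mul_pos (neg_pos.2 (not_le.1 h)) huv]
    have h6 : ‖z‖ = inner ℝ u z := by
      rw [← sq_eq_sq₀ (norm_nonneg z) h5]; linarith
    linarith
  rcases eq_or_lt_of_le (show 0 ≤ σ * cross u y - σ * cross u q by linarith) with h | h
  · refine ⟨y, right_mem_segment ℝ q y, key y ?_ hy₁ hyr⟩
    have hσ : σ ≠ 0 := by rintro rfl; simp at huv
    have : σ * cross u y = 0 := by linarith
    simpa [hσ] using this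
  · set a := σ * cross u y / (σ * cross u y - σ * cross u q) with ha
    set b := -(σ * cross u q) / (σ * cross u y - σ * cross u q) with hb
    have ha0 : 0 ≤ a := div_nonneg hy₂ h.le
    have hb0 : 0 ≤ b := div_nonneg (by linarith) h.le
    have hab : a + b = 1 := by
      rw [ha, hb, ← add_div, ← sub_eq_add_neg]
      exact div_self h.ne'
    refine ⟨a • q + b • y, ⟨a, b, ha0, hb0, hab, rfl⟩, key _ ?_ ?_ ?_⟩
    · have hσ : σ ≠ 0 := by rintro rfl; simp at huv
      have : σ * cross u (a • q + b • y) = 0 := by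
        rw [cross_add_smul, ha, hb]; field_simp; ring
      simpa [hσ] using this
    · rw [cross_add_smul]
      have := mul_nonneg ha0 hq₁
      have := mul_nonneg hb0 hy₁
      linarith
    · exact inner_combination_le ha0 hb0 hab hqr hyr

/-- A segment in `{⟪u₁, ·⟫ ≤ r} ∩ {⟪u₂, ·⟫ ≤ r}` which leaves the open cone spanned by `u₁`, `u₂`
meets the disk of radius `r` centered at the origin. -/
lemma exists_mem_segment_norm_le {r : ℝ} {u₁ u₂ q y : Plane} (hu₁ : ‖u₁‖ = 1) (hu₂ : ‖u₂‖ = 1)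
    (h₁₂ : 0 < cross u₁ u₂) (hq₁ : 0 < cross u₁ q) (hq₂ : cross u₂ q < 0)
    (hy : ¬ (0 < cross u₁ y ∧ cross u₂ y < 0))
    (hq₁r : inner ℝ u₁ q ≤ r) (hq₂r : inner ℝ u₂ q ≤ r)
    (hy₁r : inner ℝ u₁ y ≤ r) (hy₂r : inner ℝ u₂ y ≤ r) :
    ∃ z ∈ segment ℝ q y, ‖z‖ ≤ r := by
  have case1 : ∀ y : Plane, 0 ≤ cross u₁ y → 0 ≤ cross u₂ y → inner ℝ u₂ y ≤ r →
      ∃ z ∈ segment ℝ q y, ‖z‖ ≤ r := fun y h1 h2 h3 =>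
    exists_mem_segment_norm_le_of_cross (σ := 1) (v := u₁) hu₂ (by linarith) (by linarith)
      (by linarith) (by linarith) (by linarith) hq₂r h3
  have case2 : ∀ y : Plane, cross u₁ y ≤ 0 → cross u₂ y ≤ 0 → inner ℝ u₁ y ≤ r →
      ∃ z ∈ segment ℝ q y, ‖z‖ ≤ r := fun y h1 h2 h3 =>
    exists_mem_segment_norm_le_of_cross (σ := -1) (v := u₂) hu₁
      (by rw [cross_swap]; linarith) (by linarith)
      (by linarith) (by linarith) (by linarith) hq₁r h3
  rcases le_or_gt (cross u₁ y) 0 with h1 | h1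
  · rcases le_or_gt (cross u₂ y) 0 with h2 | h2
    · exact case2 y h1 h2 hy₁r
    -- Here `y` is beyond both lines. Cutting the segment where it crosses the line through `u₁`
    -- leaves a shorter segment, to which one of the two cases applies.
    · have hd : 0 < cross u₁ q - cross u₁ y := by linarith
      set a := -cross u₁ y / (cross u₁ q - cross u₁ y) with ha
      set b := cross u₁ q / (cross u₁ q - cross u₁ y) with hb
      have ha0 : 0 ≤ a := div_nonneg (by linarith) hd.le
      have hb0 : 0 ≤ b := div_nonneg hq₁.le hd.le
      have hab : a + b = 1 := by rw [ha, hb]; field_simp; ring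
      have hz : a • q + b • y ∈ segment ℝ q y := ⟨a, b, ha0, hb0, hab, rfl⟩
      have hz1 : cross u₁ (a • q + b • y) = 0 := by
        rw [cross_add_smul, ha, hb]; field_simp; ring
      have hsub : segment ℝ q (a • q + b • y) ⊆ segment ℝ q y :=
        (convex_segment q y).segment_subset (left_mem_segment ℝ q y) hz
      have hr1 : inner ℝ u₁ (a • q + b • y) ≤ r :=
        inner_combination_le ha0 hb0 hab hq₁r hy₁r
      have hr2 : inner ℝ u₂ (a • q + b • y) ≤ r :=
        inner_combination_le ha0 hb0 hab hq₂r hy₂r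
      have : ∃ z ∈ segment ℝ q (a • q + b • y), ‖z‖ ≤ r := by
        rcases le_total (cross u₂ (a • q + b • y)) 0 with h | h
        · exact case2 _ hz1.le h hr1
        · exact case1 _ hz1.ge h hr2
      obtain ⟨z, hz, hzr⟩ := this
      exact ⟨z, hsub hz, hzr⟩
  · have h2 : 0 ≤ cross u₂ y := by
      by_contra h
      exact hy ⟨h1, not_le.1 h⟩
    exact case1 y h1.le h2 hy₂r

/-- A point of `{⟪u₁, ·⟫ ≤ r} ∩ {⟪u₂, ·⟫ ≤ r}` beyond the line `⟪u₃, ·⟫ = -r` lies in the open cone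
spanned by `u₁` and `u₂`. -/
lemma cross_pos_of_inner_lt {r a₁ a₂ a₃ : ℝ} {u₁ u₂ u₃ q : Plane} (hr : 0 ≤ r)
    (ha₁ : 0 < a₁) (ha₂ : 0 < a₂) (ha₃ : 0 < a₃)
    (hsum : a₁ • u₁ + a₂ • u₂ + a₃ • u₃ = 0)
    (hu₁ : ‖u₁‖ = 1) (hu₂ : ‖u₂‖ = 1) (hu₃ : ‖u₃‖ = 1)
    (hq₁ : inner ℝ u₁ q ≤ r) (hq₂ : inner ℝ u₂ q ≤ r) (hq₃ : inner ℝ u₃ q < -r) {σ : ℝ}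
    (h₃₁ : 0 < σ * cross u₃ u₁) : 0 < σ * cross u₁ q := by
  by_contra hcon
  rw [not_lt] at hcon
  have e : inner ℝ u₃ q = inner ℝ u₁ q * inner ℝ u₁ u₃ - cross u₁ q * cross u₃ u₁ := by
    have h := Plane.norm_sq_eq u₁
    rw [hu₁] at h
    simp only [Plane.inner_eq, cross]
    linear_combination (u₃ 0 * q 0 + u₃ 1 * q 1) * h
  have hp : 0 ≤ -(cross u₁ q * cross u₃ u₁) := by
    have h1 : 0 ≤ (-(σ * cross u₁ q)) * (σ * cross u₃ u₁) :=
      mul_nonneg (by linarith) h₃₁.le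
    have hσ : 0 < σ ^ 2 := by
      have : σ ≠ 0 := by rintro rfl; simp at h₃₁
      positivity
    by_contra h
    nlinarith [mul_pos hσ (neg_pos.2 (not_le.1 h))]
  have hab := abs_le.1 (abs_real_inner_le_norm u₁ u₃)
  rw [hu₁, hu₃] at hab
  -- Since `e` and `hp` give `⟪u₃, q⟫ ≥ ⟪u₁, q⟫ ⟪u₁, u₃⟫`, the bound `|⟪u₁, q⟫| ≤ r` would
  -- contradict `hq₃`.
  have h1 : inner ℝ u₁ q < -r := by
    by_contra h
    rw [not_lt] at h
    nlinarith [mul_nonneg (sub_nonneg.2 hq₁) (by linarith [hab.1] : 0 ≤ 1 + inner ℝ u₁ u₃),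
      mul_nonneg (by linarith : 0 ≤ inner ℝ u₁ q + r) (by linarith [hab.2] : 0 ≤ 1 - inner ℝ u₁ u₃)]
  have h2 : a₁ * inner ℝ u₁ q + a₂ * inner ℝ u₂ q + a₃ * inner ℝ u₃ q = 0 := by
    have := congrArg (fun w => inner ℝ w q) hsum
    simpa [inner_add_left, real_inner_smul_left] using this
  -- The triangle inequality in `hsum`. It makes the weighted sum in `h2` negative, being less than
  -- `r * (a₂ - a₁ - a₃)`.
  have h3 : a₂ ≤ a₁ + a₃ := by
    have : a₂ • u₂ = -(a₁ • u₁ + a₃ • u₃) := by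
      rw [eq_neg_iff_add_eq_zero, ← hsum]; abel
    calc a₂ = ‖a₂ • u₂‖ := by rw [norm_smul, hu₂, Real.norm_of_nonneg ha₂.le, mul_one]
      _ ≤ ‖a₁ • u₁‖ + ‖a₃ • u₃‖ := by rw [this, norm_neg]; exact norm_add_le _ _
      _ = a₁ + a₃ := by
        rw [norm_smul, norm_smul, hu₁, hu₃, Real.norm_of_nonneg ha₁.le,
          Real.norm_of_nonneg ha₃.le, mul_one, mul_one]
  nlinarith [mul_lt_mul_of_pos_left h1 ha₁, mul_lt_mul_of_pos_left hq₃ ha₃,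
    mul_le_mul_of_nonneg_left hq₂ ha₂.le, mul_le_mul_of_nonneg_right h3 hr]


/-! ### Viewing angles and the circumradius of a triangle. -/

/-- The angle at `q` between the direction to the center of a disk and the direction to `y`, if the
segment from `q` to `y` meets the disk. -/
lemma angle_le_arcsin {V : Type*} [NormedAddCommGroup V] [InnerProductSpace ℝ V]
    {r : ℝ} {q y z : V} (hz : z ∈ segment ℝ q y) (hzr : ‖z‖ ≤ r) (hq : r < ‖q‖) :
    angle (-q) (y - q) ≤ Real.arcsin (r / ‖q‖) := by
  have hr : 0 ≤ r := (norm_nonneg z).trans hzr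
  have hq0 : 0 < ‖q‖ := hr.trans_lt hq
  obtain ⟨a, b, ha, hb, hab, rfl⟩ := hz
  have hb0 : 0 < b := by
    rcases hb.eq_or_lt with h | h
    · exfalso
      subst h
      have : a = 1 := by linarith
      subst this
      simp at hzr
      linarith
    · exact h
  have hzq : a • q + b • y = q + b • (y - q) := by
    rw [show a = 1 - b by linarith]; module
  set d := b • (y - q) with hd
  have hang : angle (-q) (y - q) = angle (-q) d := by
    rw [hd, angle_smul_right_of_pos _ _ hb0]
  rw [hzq] at hzr
  have h1 : ‖q + d‖ ^ 2 ≤ r ^ 2 := by gcongr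
  rw [norm_add_sq_real] at h1
  have hd0 : 0 < ‖d‖ := by
    by_contra h
    have : ‖d‖ = 0 := le_antisymm (not_lt.1 h) (norm_nonneg d)
    rw [norm_eq_zero] at this
    rw [this, add_zero] at hzr
    linarith
  have hrq : 0 ≤ 1 - (r / ‖q‖) ^ 2 := by
    have : r / ‖q‖ ≤ 1 := (div_le_one hq0).2 hq.le
    have : 0 ≤ r / ‖q‖ := by positivity
    nlinarith
  rw [hang, ← Real.arccos_cos (angle_nonneg _ _) (angle_le_pi _ _),
    Real.arcsin_eq_arccos (by positivity)]
  apply Real.arccos_le_arccos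
  rw [cos_angle, le_div_iff₀ (by rw [norm_neg]; positivity), inner_neg_left, norm_neg]
  set w := √(1 - (r / ‖q‖) ^ 2) with hw
  have hw2 : w ^ 2 = 1 - (r / ‖q‖) ^ 2 := Real.sq_sqrt hrq
  have hw3 : (w * ‖q‖) ^ 2 = ‖q‖ ^ 2 - r ^ 2 := by
    rw [mul_pow, hw2]; field_simp
  -- `h1` bounds `-⟪q, d⟫` below by half of `‖q‖² - r² + ‖d‖²`. By AM-GM this is at least `w * ‖q‖ *
  -- ‖d‖`, as `w * ‖q‖` is the tangent length.
  nlinarith [sq_nonneg (w * ‖q‖ - ‖d‖)]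

/-- The cosine of the angle under which two points are seen, if both lines of sight meet a disk. -/
lemma le_cos_angle_of_segments_meet_ball {V : Type*} [NormedAddCommGroup V]
    [InnerProductSpace ℝ V] {r : ℝ} {q x y z z' : V}
    (hz : z ∈ segment ℝ q x) (hzr : ‖z‖ ≤ r) (hz' : z' ∈ segment ℝ q y) (hzr' : ‖z'‖ ≤ r)
    (hq : r < ‖q‖) :
    1 - 2 * (r / ‖q‖) ^ 2 ≤ Real.cos (angle (x - q) (y - q)) := by
  have hr : 0 ≤ r := (norm_nonneg z).trans hzr
  have hq0 : 0 < ‖q‖ := hr.trans_lt hq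
  have h1 := angle_le_arcsin hz hzr hq
  have h2 := angle_le_arcsin hz' hzr' hq
  have h3 := angle_le_angle_add_angle (x - q) (-q) (y - q)
  rw [angle_comm (x - q) (-q)] at h3
  have h4 : r / ‖q‖ ≤ 1 := (div_le_one hq0).2 hq.le
  have h5 : 0 ≤ r / ‖q‖ := by positivity
  have h6 : Real.arcsin (r / ‖q‖) ≤ Real.pi / 2 := Real.arcsin_le_pi_div_two _
  calc 1 - 2 * (r / ‖q‖) ^ 2 = Real.cos (2 * Real.arcsin (r / ‖q‖)) := by
        rw [Real.cos_two_mul, Real.cos_arcsin, Real.sq_sqrt (by nlinarith)]; ring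
    _ ≤ _ := by
        apply Real.cos_le_cos_of_nonneg_of_le_pi (angle_nonneg _ _) (by linarith) (by linarith)

/-- The circumradius of a non-obtuse triangle bounds the radius of every ball containing it. -/
lemma circumradius_sq_mul_le {V : Type*} [NormedAddCommGroup V] [InnerProductSpace ℝ V]
    {a b v : V} {ρ : ℝ} (h₀ : ‖v‖ ≤ ρ) (h₁ : ‖a - v‖ ≤ ρ) (h₂ : ‖b - v‖ ≤ ρ)
    (hP : 0 ≤ inner ℝ a b) (ha : ‖a‖ ≤ ‖a - b‖) (hb : ‖b‖ ≤ ‖a - b‖) :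
    ‖a‖ ^ 2 * ‖b‖ ^ 2 * ‖a - b‖ ^ 2 ≤
      4 * (‖a‖ ^ 2 * ‖b‖ ^ 2 - inner ℝ a b ^ 2) * ρ ^ 2 := by
  set A := ‖a‖ ^ 2 with hA
  set B := ‖b‖ ^ 2 with hB
  set P := inner ℝ a b with hPdef
  have hD : ‖a - b‖ ^ 2 = A + B - 2 * P := by rw [norm_sub_sq_real]; ring
  have ha' : A ≤ ‖a - b‖ ^ 2 := by rw [hA]; gcongr
  have hb' : B ≤ ‖a - b‖ ^ 2 := by rw [hB]; gcongr
  have h₀' : ‖v‖ ^ 2 ≤ ρ ^ 2 := by gcongr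
  have h₁' : ‖a - v‖ ^ 2 ≤ ρ ^ 2 := by gcongr
  have h₂' : ‖b - v‖ ^ 2 ≤ ρ ^ 2 := by gcongr
  rw [norm_sub_sq_real, ← hA] at h₁'
  rw [norm_sub_sq_real, ← hB] at h₂'
  rw [hD] at ha' hb' ⊢
  have hA0 : 0 ≤ A := by positivity
  have hB0 : 0 ≤ B := by positivity
  have hcs : P ^ 2 ≤ A * B := by
    have := abs_real_inner_le_norm a b
    rw [hA, hB, ← mul_pow]
    exact sq_le_sq' (by linarith [(abs_le.1 this).1]) (abs_le.1 this).2
  set Δ := A * B - P ^ 2 with hΔ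
  set Va := inner ℝ a v
  set Vb := inner ℝ b v
  rcases eq_or_lt_of_le (show 0 ≤ Δ by linarith) with h | h
  · have hP0 : A * B = 0 := by
      have h4 : (2 * P) ^ 2 ≤ A * B := by
        nlinarith [mul_nonneg hP (by linarith : 0 ≤ B - 2 * P), mul_nonneg (by linarith : 0 ≤ A - 2 * P) hB0]
      nlinarith
    rw [hP0, ← h]; simp
  -- This vector vanishes exactly when `v` is the circumcenter. The weights of `e1`, `e2`, `e3` are
  -- the barycentric coordinates of the circumcenter times `4 * Δ`, nonnegative because the triangle
  -- is not obtuse.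
  · have hw : 0 ≤ ‖(2 * Δ) • v - (B * (A - P)) • a - (A * (B - P)) • b‖ ^ 2 := by positivity
    have hexp : ‖(2 * Δ) • v - (B * (A - P)) • a - (A * (B - P)) • b‖ ^ 2
        = (2 * Δ) ^ 2 * ‖v‖ ^ 2 + (B * (A - P)) ^ 2 * A + (A * (B - P)) ^ 2 * B
          - 2 * (2 * Δ) * (B * (A - P)) * Va - 2 * (2 * Δ) * (A * (B - P)) * Vb
          + 2 * (B * (A - P)) * (A * (B - P)) * P := by
      rw [norm_sub_sq_real, norm_sub_sq_real, inner_sub_left]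
      simp only [norm_smul, mul_pow, real_inner_smul_left, real_inner_smul_right, Real.norm_eq_abs,
        sq_abs, ← hA, ← hB, ← hPdef, real_inner_comm a v, real_inner_comm b v]
      ring
    rw [hexp] at hw
    have e1 : 0 ≤ B * (2 * A - 2 * P) * (ρ ^ 2 - (A - 2 * Va + ‖v‖ ^ 2)) :=
      mul_nonneg (mul_nonneg hB0 (by linarith)) (by linarith)
    have e2 : 0 ≤ A * (2 * B - 2 * P) * (ρ ^ 2 - (B - 2 * Vb + ‖v‖ ^ 2)) :=
      mul_nonneg (mul_nonneg hA0 (by linarith)) (by linarith)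
    have e3 : 0 ≤ (A + B - 2 * P) * (2 * P) * (ρ ^ 2 - ‖v‖ ^ 2) :=
      mul_nonneg (mul_nonneg (by linarith) (by linarith)) (by linarith)
    have hfin : 0 ≤ Δ * (4 * Δ * ρ ^ 2 - A * B * (A + B - 2 * P)) := by
      have : Δ * (4 * Δ * ρ ^ 2 - A * B * (A + B - 2 * P)) =
          Δ * (B * (2 * A - 2 * P) * (ρ ^ 2 - (A - 2 * Va + ‖v‖ ^ 2)) +
            A * (2 * B - 2 * P) * (ρ ^ 2 - (B - 2 * Vb + ‖v‖ ^ 2)) +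
            (A + B - 2 * P) * (2 * P) * (ρ ^ 2 - ‖v‖ ^ 2)) +
          ((2 * Δ) ^ 2 * ‖v‖ ^ 2 + (B * (A - P)) ^ 2 * A + (A * (B - P)) ^ 2 * B
          - 2 * (2 * Δ) * (B * (A - P)) * Va - 2 * (2 * Δ) * (A * (B - P)) * Vb
          + 2 * (B * (A - P)) * (A * (B - P)) * P) := by
        rw [hΔ]; ring
      rw [this]
      have := mul_nonneg h.le (add_nonneg (add_nonneg e1 e2) e3)
      linarith
    have := (mul_nonneg_iff_of_pos_left h).1 hfin
    linarith

/-! ### Breadth, width, inradius and circumradius -/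

lemma exists_norm_eq_one_plane : ∃ u : Plane, ‖u‖ = 1 :=
  ⟨EuclideanSpace.single 0 1, by simp⟩

lemma isCompact_inner_image {K : Set Plane} (hK : IsCompact K) (u : Plane) :
    IsCompact ((fun x : Plane => inner ℝ u x) '' K) :=
  hK.image (by fun_prop)

lemma inner_sub_inner_le_breadth {K : Set Plane} (hK : IsCompact K) {x y : Plane} (hx : x ∈ K)
    (hy : y ∈ K) (u : Plane) : inner ℝ u x - inner ℝ u y ≤ breadth K u :=
  sub_le_sub (le_csSup (isCompact_inner_image hK u).bddAbove ⟨x, hx, rfl⟩)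
    (csInf_le (isCompact_inner_image hK u).bddBelow ⟨y, hy, rfl⟩)

lemma breadth_nonneg {K : Set Plane} (hK : IsCompact K) (hne : K.Nonempty) (u : Plane) :
    0 ≤ breadth K u := by
  obtain ⟨x, hx⟩ := hne
  simpa using inner_sub_inner_le_breadth hK hx hx u

lemma minWidth_le_breadth {K : Set Plane} (hK : IsCompact K) (hne : K.Nonempty) {u : Plane}
    (hu : ‖u‖ = 1) : minWidth K ≤ breadth K u := by
  refine csInf_le ⟨0, ?_⟩ ⟨u, by simpa using hu, rfl⟩
  rintro _ ⟨v, -, rfl⟩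
  exact breadth_nonneg hK hne v

lemma le_minWidth {K : Set Plane} {w : ℝ} (h : ∀ u : Plane, ‖u‖ = 1 → w ≤ breadth K u) :
    w ≤ minWidth K := by
  obtain ⟨u, hu⟩ := exists_norm_eq_one_plane
  refine le_csInf ⟨_, u, by simpa using hu, rfl⟩ ?_
  rintro _ ⟨v, hv, rfl⟩
  exact h v (by simpa using hv)

lemma minWidth_le_of_inner_le {K : Set Plane} (hK : IsCompact K) (hne : K.Nonempty) {u : Plane}
    (hu : ‖u‖ = 1) {m M : ℝ} (hM : ∀ x ∈ K, inner ℝ u x ≤ M) (hm : ∀ x ∈ K, m ≤ inner ℝ u x) :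
    minWidth K ≤ M - m := by
  refine (minWidth_le_breadth hK hne hu).trans (sub_le_sub ?_ ?_)
  · exact csSup_le (hne.image _) (by rintro _ ⟨x, hx, rfl⟩; exact hM x hx)
  · exact le_csInf (hne.image _) (by rintro _ ⟨x, hx, rfl⟩; exact hm x hx)

/-- With `M` the level of a contact line, this supplies the far points q of the main argument. -/
lemma exists_inner_lt_of_lt_minWidth {K : Set Plane} (hK : IsCompact K) (hne : K.Nonempty)
    {u : Plane} (hu : ‖u‖ = 1) {M W : ℝ} (hM : ∀ x ∈ K, inner ℝ u x ≤ M) (hW : W < minWidth K) :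
    ∃ q ∈ K, inner ℝ u q < M - W := by
  by_contra! h
  linarith [minWidth_le_of_inner_le hK hne hu hM h]

lemma le_diam_of_closedBall_subset {K : Set Plane} (hK : IsCompact K) {c : Plane} {ρ : ℝ}
    (hρ : 0 ≤ ρ) (h : Metric.closedBall c ρ ⊆ K) : ρ ≤ Metric.diam K := by
  obtain ⟨u, hu⟩ := exists_norm_eq_one_plane
  have := Metric.dist_le_diam_of_mem hK.isBounded
    (h (show c + ρ • u ∈ Metric.closedBall c ρ by
      simp [norm_smul, hu, abs_of_nonneg hρ])) (h (Metric.mem_closedBall_self hρ))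
  simpa [norm_smul, hu, abs_of_nonneg hρ] using this

lemma le_inradius {K : Set Plane} (hK : IsCompact K) {c : Plane} {ρ : ℝ}
    (hρ : 0 ≤ ρ) (h : Metric.closedBall c ρ ⊆ K) : ρ ≤ inradius K :=
  le_csSup ⟨Metric.diam K, fun _ ⟨h0, _, h1⟩ => le_diam_of_closedBall_subset hK h0 h1⟩ ⟨hρ, c, h⟩

lemma inradius_nonneg (K : Set Plane) : 0 ≤ inradius K :=
  Real.sSup_nonneg fun _ h => h.1

lemma inradius_le {K : Set Plane} {r : ℝ} (hr : 0 ≤ r)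
    (h : ∀ c ρ, 0 ≤ ρ → Metric.closedBall c ρ ⊆ K → ρ ≤ r) : inradius K ≤ r :=
  Real.sSup_le (fun ρ ⟨h0, c, h1⟩ => h c ρ h0 h1) hr

/-- A compact set contains a disk whose radius is the inradius. -/
lemma exists_closedBall_inradius_subset {K : Set Plane} (hK : IsCompact K) (hne : K.Nonempty) :
    ∃ c, Metric.closedBall c (inradius K) ⊆ K := by
  -- The center is a point of `K` farthest from the complement.
  obtain ⟨c, hc, hmax⟩ := hK.exists_isMaxOn hne
    (Metric.continuous_infDist_pt (Kᶜ)).continuousOn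
  have hcne : (Kᶜ).Nonempty := Set.nonempty_compl.2 hK.ne_univ
  have hle : inradius K ≤ Metric.infDist c Kᶜ := by
    refine inradius_le Metric.infDist_nonneg fun c' ρ h0 h1 => ?_
    refine le_trans ?_ (hmax (h1 (Metric.mem_closedBall_self h0)))
    refine (Metric.le_infDist hcne).2 fun y hy => ?_
    by_contra h
    exact hy (h1 (by rw [Metric.mem_closedBall, dist_comm]; exact (not_le.1 h).le))
  refine ⟨c, (Metric.closedBall_subset_closedBall hle).trans ?_⟩
  rcases eq_or_ne (Metric.infDist c Kᶜ) 0 with h | h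
  · rw [h, Metric.closedBall_zero]; simpa using hc
  · rw [← closure_ball c h]
    exact hK.isClosed.closure_subset_iff.2 Metric.ball_infDist_compl_subset

lemma circumradius_le {K : Set Plane} {c : Plane} {ρ : ℝ} (hρ : 0 ≤ ρ)
    (h : K ⊆ Metric.closedBall c ρ) : circumradius K ≤ ρ :=
  csInf_le ⟨0, fun _ h => h.1⟩ ⟨hρ, c, h⟩

lemma le_circumradius {K : Set Plane} (hK : IsCompact K) {v : ℝ}
    (h : ∀ c ρ, 0 ≤ ρ → K ⊆ Metric.closedBall c ρ → v ≤ ρ) : v ≤ circumradius K := by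
  obtain ⟨ρ, hρ⟩ := hK.isBounded.subset_closedBall 0
  exact le_csInf ⟨max ρ 0, le_max_right _ _, 0,
    hρ.trans (Metric.closedBall_subset_closedBall (le_max_left _ _))⟩ fun ρ ⟨h0, c, h1⟩ => h c ρ h0 h1

lemma diam_le_two_mul_circumradius {K : Set Plane} (hK : IsCompact K) :
    Metric.diam K ≤ 2 * circumradius K := by
  have : Metric.diam K / 2 ≤ circumradius K := by
    refine le_circumradius hK fun c ρ h0 h1 => ?_
    have := (Metric.diam_mono h1 Metric.isBounded_closedBall).trans (Metric.diam_closedBall h0)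
    linarith
  linarith

lemma diam_pos_of_nontrivial {K : Set Plane} (hK : IsCompact K) (hn : K.Nontrivial) :
    0 < Metric.diam K := by
  obtain ⟨x, hx, y, hy, hxy⟩ := hn
  exact (dist_pos.2 hxy).trans_le (Metric.dist_le_diam_of_mem hK.isBounded hx hy)

lemma exists_dist_eq_diam_of_isCompact {K : Set Plane} (hK : IsCompact K) (hne : K.Nonempty) :
    ∃ x ∈ K, ∃ y ∈ K, dist x y = Metric.diam K := by
  obtain ⟨⟨x, y⟩, ⟨hx, hy⟩, hmax⟩ := (hK.prod hK).exists_isMaxOn (hne.prod hne)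
    (f := fun p : Plane × Plane => dist p.1 p.2) (by fun_prop)
  refine ⟨x, hx, y, hy, le_antisymm (Metric.dist_le_diam_of_mem hK.isBounded hx hy)
    (Metric.diam_le_of_forall_dist_le dist_nonneg fun a ha b hb => ?_)⟩
  exact isMaxOn_iff.1 hmax (a, b) ⟨ha, hb⟩

/-! ### Contact normals of an incircle -/

/-- Carathéodory's theorem in the plane, with exactly three points. -/
lemma exists_three_of_mem_convexHull {N : Set Plane} {x : Plane} (hx : x ∈ convexHull ℝ N) :
    ∃ (u : Fin 3 → Plane) (a : Fin 3 → ℝ), (∀ i, u i ∈ N) ∧ (∀ i, 0 ≤ a i) ∧ ∑ i, a i = 1 ∧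
      ∑ i, a i • u i = x := by
  obtain ⟨ι, _, z, w, hz, hind, hw, hw1, hwz⟩ := eq_pos_convex_span_of_mem_convexHull hx
  have hcard : Fintype.card ι ≤ Fintype.card (Fin 3) := by
    have h1 := hind.card_le_finrank_succ
    have h2 := Submodule.finrank_le (vectorSpan ℝ (Set.range z))
    simp at h2 ⊢
    omega
  obtain ⟨e⟩ := Function.Embedding.nonempty_of_card_le hcard
  obtain ⟨y, hy⟩ := convexHull_nonempty_iff.1 ⟨x, hx⟩
  -- Affine independence leaves at most three points. The missing ones are filled in by an arbitrary
  -- `y ∈ N` with weight 0.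
  have hext : ∀ i, Function.extend e w (0 : Fin 3 → ℝ) (e i) = w i := fun i => e.injective.extend_apply w _ i
  have hext' : ∀ i, Function.extend e z (fun _ => y) (e i) = z i :=
    fun i => e.injective.extend_apply z _ i
  have h0 : ∀ i, i ∉ Set.range e → Function.extend e w (0 : Fin 3 → ℝ) i = 0 := fun i hi =>
    Function.extend_apply' w _ i hi
  refine ⟨Function.extend e z fun _ => y, Function.extend e w (0 : Fin 3 → ℝ), fun i => ?_, fun i => ?_, ?_, ?_⟩
  · by_cases h : i ∈ Set.range e
    · obtain ⟨j, rfl⟩ := h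
      rw [hext']
      exact hz ⟨j, rfl⟩
    · rw [Function.extend_apply' _ _ _ h]
      exact hy
  · by_cases h : i ∈ Set.range e
    · obtain ⟨j, rfl⟩ := h
      rw [hext]
      exact (hw j).le
    · rw [h0 i h]
  · rw [← hw1]
    exact (Fintype.sum_of_injective e e.injective _ _ h0 fun i => (hext i).symm).symm
  · rw [← hwz]
    refine (Fintype.sum_of_injective e e.injective _ _ (fun i hi => ?_) fun i => ?_).symm
    · rw [h0 i hi, zero_smul]
    · rw [hext, hext']

/-- By Carathéodory, the hull is a continuous image of three copies of `N` times a simplex. -/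
lemma isCompact_convexHull_plane {N : Set Plane} (hN : IsCompact N) :
    IsCompact (convexHull ℝ N) := by
  have h : convexHull ℝ N = (fun p : (Fin 3 → Plane) × (Fin 3 → ℝ) => ∑ i, p.2 i • p.1 i) ''
      ((Set.univ.pi fun _ => N) ×ˢ stdSimplex ℝ (Fin 3)) := by
    ext x
    constructor
    · intro hx
      obtain ⟨u, a, hu, ha, ha1, hx⟩ := exists_three_of_mem_convexHull hx
      exact ⟨(u, a), ⟨fun i _ => hu i, ha, ha1⟩, hx⟩
    · rintro ⟨⟨u, a⟩, ⟨hu, ha, ha1⟩, rfl⟩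
      exact (convex_convexHull ℝ N).sum_mem (fun i _ => ha i) ha1
        fun i _ => subset_convexHull ℝ N (hu i trivial)
  rw [h]
  exact ((isCompact_univ_pi fun _ => hN).prod (isCompact_stdSimplex ℝ (Fin 3))).image
    (by fun_prop)

/-- A point outside of a closed convex set is separated from it by a unit vector. -/
lemma exists_unit_inner_lt {K : Set Plane} (hK : IsClosed K) (hconv : Convex ℝ K)
    (hne : K.Nonempty) {b : Plane} (hb : b ∉ K) :
    ∃ u : Plane, ‖u‖ = 1 ∧ ∀ x ∈ K, inner ℝ u x < inner ℝ u b := by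
  obtain ⟨f, s, h1, h2⟩ := geometric_hahn_banach_closed_point hconv hK hb
  set v := (InnerProductSpace.toDual ℝ Plane).symm f with hv
  have hf : ∀ x, f x = inner ℝ v x := fun x => by
    rw [hv, InnerProductSpace.toDual_symm_apply]
  have hv0 : 0 < ‖v‖ := by
    rw [norm_pos_iff]
    intro h0
    obtain ⟨x, hx⟩ := hne
    have := (h1 x hx).trans h2
    rw [hf, hf, h0] at this
    simp at this
  refine ⟨‖v‖⁻¹ • v, by rw [norm_smul, norm_inv, norm_norm, inv_mul_cancel₀ hv0.ne'], ?_⟩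
  intro x hx
  rw [real_inner_smul_left, real_inner_smul_left, ← hf, ← hf]
  exact mul_lt_mul_of_pos_left ((h1 x hx).trans h2) (by positivity)

/-- At a largest inscribed disk the contact normals positively span the origin. -/
lemma zero_mem_convexHull_contact_normals {K : Set Plane} (hK : IsConvexBody K) {c : Plane} {r : ℝ}
    (hr : 0 ≤ r) (hc : Metric.closedBall c r ⊆ K)
    (hmax : ∀ c' r', 0 ≤ r' → Metric.closedBall c' r' ⊆ K → r' ≤ r) :
    (0 : Plane) ∈ convexHull ℝ {u : Plane | ‖u‖ = 1 ∧ ∀ x ∈ K, inner ℝ u (x - c) ≤ r} := by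
  set N := {u : Plane | ‖u‖ = 1 ∧ ∀ x ∈ K, inner ℝ u (x - c) ≤ r} with hN
  have hNcl : IsClosed N := by
    have : N = {u : Plane | ‖u‖ = 1} ∩ ⋂ x ∈ K, {u : Plane | inner ℝ u (x - c) ≤ r} := by
      ext u; simp [hN]
    rw [this]
    refine (isClosed_eq continuous_norm continuous_const).inter
      (isClosed_biInter fun x _ => isClosed_le (by fun_prop) continuous_const)
  have hsph : IsCompact {u : Plane | ‖u‖ = 1} := by
    have h : {u : Plane | ‖u‖ = 1} = Metric.sphere (0 : Plane) 1 := by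
      ext u
      simp
    exact h ▸ isCompact_sphere (0 : Plane) 1
  have hNc : IsCompact N := hsph.of_isClosed_subset hNcl fun u hu => hu.1
  by_contra h0
  -- If 0 is not in the hull, some direction `v` leads away from every contact line. Without contact
  -- normals `v = 0` serves vacuously.
  obtain ⟨v, hv⟩ : ∃ v : Plane, ∀ u ∈ N, inner ℝ u v < 0 := by
    rcases N.eq_empty_or_nonempty with he | hne
    · exact ⟨0, fun u hu => by rw [he] at hu; exact hu.elim⟩
    obtain ⟨v, -, hv⟩ := exists_unit_inner_lt (isCompact_convexHull_plane hNc).isClosed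
      (convex_convexHull ℝ N) hne.convexHull h0
    refine ⟨v, fun u hu => ?_⟩
    have := hv u (subset_convexHull ℝ N hu)
    rwa [inner_zero_right, real_inner_comm] at this
  -- Move the center by `t • v` and enlarge the radius by the second-order amount `t * t`, with `t =
  -- 1 / (n + 1)`. The new disk sticks out of `K`. A normal separating a protruding point has `⟪u,
  -- v⟫ ≥ -t`, since the old disk is still in `K`. A limit of such normals is a contact normal `w`
  -- with `⟪w, v⟫ ≥ 0`.
  have hstep : ∀ n : ℕ, ∃ u : Plane, ‖u‖ = 1 ∧ -(1 / ((n : ℝ) + 1)) ≤ inner ℝ u v ∧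
      ∀ x ∈ K, inner ℝ u (x - c) ≤ r + (1 / ((n : ℝ) + 1)) * (inner ℝ u v + 1 / ((n : ℝ) + 1)) := by
    intro n
    set t := 1 / ((n : ℝ) + 1) with ht
    have ht0 : 0 < t := by positivity
    obtain ⟨b, hb, hbK⟩ : ∃ b ∈ Metric.closedBall (c + t • v) (r + t * t), b ∉ K := by
      by_contra! h
      have := hmax (c + t • v) (r + t * t) (by positivity) h
      nlinarith [mul_pos ht0 ht0]
    obtain ⟨u, hu, hsep⟩ := exists_unit_inner_lt hK.isCompact.isClosed hK.convex hK.nonempty hbK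
    have hb2 : inner ℝ u (b - c) ≤ r + t * (inner ℝ u v + t) := by
      have e : b - c = t • v + (b - (c + t • v)) := by abel
      rw [e, inner_add_right, inner_smul_right]
      have h1 := real_inner_le_norm u (b - (c + t • v))
      rw [hu, one_mul] at h1
      rw [Metric.mem_closedBall, dist_eq_norm] at hb
      linarith
    have hall : ∀ x ∈ K, inner ℝ u (x - c) ≤ r + t * (inner ℝ u v + t) := fun x hx => by
      refine le_trans ?_ hb2
      rw [inner_sub_right, inner_sub_right]
      linarith [hsep x hx]
    refine ⟨u, hu, ?_, hall⟩
    have h2 := hall (c + r • u) (hc (by simp [norm_smul, hu, abs_of_nonneg hr]))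
    rw [add_sub_cancel_left, inner_smul_right, real_inner_self_eq_norm_sq, hu] at h2
    have h3 : 0 ≤ t * (inner ℝ u v + t) := by linarith
    have := (mul_nonneg_iff_of_pos_left ht0).1 h3
    linarith
  choose u hu1 hu2 hu3 using hstep
  obtain ⟨w, hw, φ, hφ, hlim⟩ := hsph.tendsto_subseq hu1
  have ht : Tendsto (fun n => 1 / ((φ n : ℝ) + 1)) atTop (𝓝 0) :=
    tendsto_one_div_add_atTop_nhds_zero_nat.comp hφ.tendsto_atTop
  have hinner : ∀ y : Plane, Tendsto (fun n => inner ℝ (u (φ n)) y) atTop (𝓝 (inner ℝ w y)) :=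
    fun y => hlim.inner tendsto_const_nhds
  have hwv : 0 ≤ inner ℝ w v := by
    refine le_of_tendsto_of_tendsto' (b := atTop) (by simpa using ht.neg) (hinner v)
      fun n => hu2 (φ n)
  have hwN : w ∈ N := by
    refine ⟨hw, fun x hx => ?_⟩
    refine le_of_tendsto_of_tendsto' (hinner (x - c)) ?_ fun n => hu3 (φ n) x hx
    simpa using tendsto_const_nhds.add (ht.mul ((hinner v).add ht))
  linarith [hv w hwN]

/-! ### Jung's theorem in the plane -/

/-- Jung for a triangle with vertices 0, `a`, `b` and longest side from `a` to `b`. If the angle at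
0 is right or obtuse the midpoint of that side works, otherwise the circumcenter. The angle at 0 is
the largest, so its cosine is at most 1/2, which is `h4`; this says that the squared circumradius is
at most a third of the squared longest side. -/
lemma exists_norm_sub_le_of_triangle {V : Type*} [NormedAddCommGroup V] [InnerProductSpace ℝ V]
    {a b : V} {D : ℝ} (ha : ‖a‖ ≤ ‖a - b‖) (hb : ‖b‖ ≤ ‖a - b‖) (hD : ‖a - b‖ ≤ D) :
    ∃ v : V, 3 * ‖v‖ ^ 2 ≤ D ^ 2 ∧ 3 * ‖v - a‖ ^ 2 ≤ D ^ 2 ∧ 3 * ‖v - b‖ ^ 2 ≤ D ^ 2 := by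
  have hD2 : ‖a - b‖ ^ 2 ≤ D ^ 2 := by gcongr
  have ha2 : ‖a‖ ^ 2 ≤ ‖a - b‖ ^ 2 := by gcongr
  have hb2 : ‖b‖ ^ 2 ≤ ‖a - b‖ ^ 2 := by gcongr
  have hab := norm_sub_sq_real a b
  rcases le_or_gt (inner ℝ a b) 0 with hP | hP
  · have h1 : ‖(1 / 2 : ℝ) • (a + b)‖ ^ 2 = (‖a‖ ^ 2 + 2 * inner ℝ a b + ‖b‖ ^ 2) / 4 := by
      rw [norm_smul, mul_pow, norm_add_sq_real]; norm_num; ring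
    have h2 : ‖(1 / 2 : ℝ) • (a + b) - a‖ ^ 2 = ‖a - b‖ ^ 2 / 4 := by
      rw [show (1 / 2 : ℝ) • (a + b) - a = (-1 / 2 : ℝ) • (a - b) by module, norm_smul, mul_pow]
      norm_num; ring
    have h3 : ‖(1 / 2 : ℝ) • (a + b) - b‖ ^ 2 = ‖a - b‖ ^ 2 / 4 := by
      rw [show (1 / 2 : ℝ) • (a + b) - b = (1 / 2 : ℝ) • (a - b) by module, norm_smul, mul_pow]
      norm_num; ring
    refine ⟨(1 / 2 : ℝ) • (a + b), ?_, ?_, ?_⟩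
    · rw [h1]; nlinarith [sq_nonneg ‖a‖, sq_nonneg ‖b‖]
    · rw [h2]; nlinarith [sq_nonneg ‖a - b‖]
    · rw [h3]; nlinarith [sq_nonneg ‖a - b‖]
  · set A := ‖a‖ ^ 2 with hA
    set B := ‖b‖ ^ 2 with hB
    set P := inner ℝ a b with hPdef
    have hA2 : 2 * P ≤ A := by linarith
    have hB2 : 2 * P ≤ B := by linarith
    have h4 : 4 * P ^ 2 ≤ A * B := by nlinarith
    have hΔ : 0 < A * B - P ^ 2 := by nlinarith
    obtain ⟨Δ, hΔdef⟩ : ∃ Δ, Δ = A * B - P ^ 2 := ⟨_, rfl⟩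
    rw [← hΔdef] at hΔ
    set α := B * (A - P) / (2 * Δ) with hα
    set β := A * (B - P) / (2 * Δ) with hβ
    have hva : inner ℝ (α • a + β • b) a = A / 2 := by
      rw [inner_add_left, real_inner_smul_left, real_inner_smul_left, real_inner_self_eq_norm_sq,
        real_inner_comm a b, ← hA, ← hPdef, hα, hβ]
      field_simp; rw [hΔdef]; ring
    have hvb : inner ℝ (α • a + β • b) b = B / 2 := by
      rw [inner_add_left, real_inner_smul_left, real_inner_smul_left, real_inner_self_eq_norm_sq,
        ← hB, ← hPdef, hα, hβ]
      field_simp; rw [hΔdef]; ring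
    have hv : ‖α • a + β • b‖ ^ 2 = A * B * (A + B - 2 * P) / (4 * Δ) := by
      rw [← real_inner_self_eq_norm_sq, inner_add_right _ (α • a) (β • b),
        inner_smul_right, inner_smul_right, hva, hvb, hα, hβ]
      field_simp; ring
    have hle : 3 * ‖α • a + β • b‖ ^ 2 ≤ D ^ 2 := by
      refine le_trans ?_ hD2
      rw [hv, ← mul_div_assoc, div_le_iff₀ (by positivity)]
      have : ‖a - b‖ ^ 2 = A + B - 2 * P := by rw [hab]; ring
      rw [this]
      nlinarith [mul_nonneg (by linarith : 0 ≤ A + B - 2 * P) (by linarith : 0 ≤ A * B - 4 * P ^ 2)]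
    refine ⟨α • a + β • b, hle, ?_, ?_⟩
    · rw [norm_sub_sq_real, hva, ← hA]; linarith
    · rw [norm_sub_sq_real, hvb, ← hB]; linarith

lemma exists_dist_sq_le_of_three {D : ℝ} {x y z : Plane} (hxy : dist x y ≤ D) (hyz : dist y z ≤ D)
    (hzx : dist z x ≤ D) :
    ∃ v, 3 * dist v x ^ 2 ≤ D ^ 2 ∧ 3 * dist v y ^ 2 ≤ D ^ 2 ∧ 3 * dist v z ^ 2 ≤ D ^ 2 := by
  have key : ∀ x y z : Plane, dist x y ≤ D → dist z x ≤ dist x y → dist z y ≤ dist x y →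
      ∃ v, 3 * dist v x ^ 2 ≤ D ^ 2 ∧ 3 * dist v y ^ 2 ≤ D ^ 2 ∧ 3 * dist v z ^ 2 ≤ D ^ 2 := by
    intro x y z h1 h2 h3
    have e : ‖(x - z) - (y - z)‖ = dist x y := by rw [sub_sub_sub_cancel_right, dist_eq_norm]
    obtain ⟨v, hv0, hva, hvb⟩ := exists_norm_sub_le_of_triangle (a := x - z) (b := y - z) (D := D)
      (by rw [e, ← dist_eq_norm, dist_comm]; exact h2)
      (by rw [e, ← dist_eq_norm, dist_comm]; exact h3) (by rw [e]; exact h1)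
    refine ⟨z + v, ?_, ?_, ?_⟩
    · rw [dist_eq_norm, show z + v - x = v - (x - z) by abel]; exact hva
    · rw [dist_eq_norm, show z + v - y = v - (y - z) by abel]; exact hvb
    · rw [dist_eq_norm, show z + v - z = v by abel]; exact hv0
  rcases le_total (dist y z) (dist x y) with h | h <;>
    rcases le_total (dist z x) (dist x y) with h' | h' <;>
    rcases le_total (dist z x) (dist y z) with h'' | h''
  · exact key x y z hxy h' (by rwa [dist_comm z y])
  · exact key x y z hxy h' (by rwa [dist_comm z y])
  · obtain ⟨v, h1, h2, h3⟩ := key z x y hzx (by linarith)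
      (by rw [dist_comm y x]; linarith)
    exact ⟨v, h2, h3, h1⟩
  · obtain ⟨v, h1, h2, h3⟩ := key z x y hzx (by linarith)
      (by rw [dist_comm y x]; linarith)
    exact ⟨v, h2, h3, h1⟩
  · obtain ⟨v, h1, h2, h3⟩ := key y z x hyz (by linarith) (by rw [dist_comm x z]; linarith)
    exact ⟨v, h3, h1, h2⟩
  · obtain ⟨v, h1, h2, h3⟩ := key y z x hyz (by linarith) (by rw [dist_comm x z]; linarith)
    exact ⟨v, h3, h1, h2⟩
  · obtain ⟨v, h1, h2, h3⟩ := key y z x hyz (by linarith) (by rw [dist_comm x z]; linarith)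
    exact ⟨v, h3, h1, h2⟩
  · obtain ⟨v, h1, h2, h3⟩ := key z x y hzx (by linarith)
      (by rw [dist_comm y x]; linarith)
    exact ⟨v, h2, h3, h1⟩

/-- **Jung's theorem** in the plane. -/
theorem three_mul_circumradius_sq_le {K : Set Plane} (hK : IsCompact K) :
    3 * circumradius K ^ 2 ≤ Metric.diam K ^ 2 := by
  set D := Metric.diam K with hD
  have hD0 : 0 ≤ D := Metric.diam_nonneg
  have h3 : (D / √3) ^ 2 = D ^ 2 / 3 := by rw [div_pow, Real.sq_sqrt (by norm_num)]
  have hdist : ∀ x ∈ K, ∀ y ∈ K, dist x y ≤ D := fun x hx y hy =>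
    Metric.dist_le_diam_of_mem hK.isBounded hx hy
  -- By Helly, three disks at a time suffice. A common point of all the disks is the center of a
  -- disk of radius `D / √3` containing `K`.
  have hne : (⋂ x : K, Metric.closedBall (x : Plane) (D / √3)).Nonempty := by
    refine Convex.helly_theorem_compact' (𝕜 := ℝ) (fun x => convex_closedBall _ _)
      (fun x => isCompact_closedBall _ _) fun I hI => ?_
    have key : ∀ x y z : K, (∀ w ∈ I, w = x ∨ w = y ∨ w = z) →
        (⋂ i ∈ I, Metric.closedBall (i : Plane) (D / √3)).Nonempty := by
      intro x y z hxyz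
      obtain ⟨v, h1, h2, h4⟩ := exists_dist_sq_le_of_three (hdist x x.2 y y.2) (hdist y y.2 z z.2)
        (hdist z z.2 x x.2)
      refine ⟨v, Set.mem_iInter₂.2 fun w hw => ?_⟩
      have : ∀ p : Plane, 3 * dist v p ^ 2 ≤ D ^ 2 → v ∈ Metric.closedBall p (D / √3) := by
        intro p hp
        refine (abs_le_of_sq_le_sq' (a := dist v p) ?_ (by positivity)).2
        rw [h3]; linarith
      rcases hxyz w hw with rfl | rfl | rfl
      exacts [this _ h1, this _ h2, this _ h4]
    have hI3 : I.card ≤ 3 := by simpa using hI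
    interval_cases h : I.card
    · rw [Finset.card_eq_zero] at h
      subst h
      simp
    · obtain ⟨x, rfl⟩ := Finset.card_eq_one.1 h
      exact key x x x (by simp)
    · obtain ⟨x, y, -, rfl⟩ := Finset.card_eq_two.1 h
      exact key x y y (by simp)
    · obtain ⟨x, y, z, -, -, -, rfl⟩ := Finset.card_eq_three.1 h
      exact key x y z (by simp)
  obtain ⟨v, hv⟩ := hne
  have hR : circumradius K ≤ D / √3 := by
    refine circumradius_le (c := v) (by positivity) fun x hx => ?_
    rw [Metric.mem_closedBall, dist_comm]
    exact Set.mem_iInter.1 hv ⟨x, hx⟩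
  have hR0 : 0 ≤ circumradius K := Real.sInf_nonneg fun _ h => h.1
  have : circumradius K ^ 2 ≤ (D / √3) ^ 2 := by gcongr
  rw [h3] at this
  linarith

lemma circumradius_pos {K : Set Plane} (hK : IsCompact K) (hn : K.Nontrivial) :
    0 < circumradius K := by
  linarith [diam_le_two_mul_circumradius hK, diam_pos_of_nontrivial hK hn]

/-- The factor `boatFactor K` is `1 + s`, where `s ^ 2 * (1 - C) = 2` and `C` is the cosine of the
angle in `[π / 3, π / 2]` whose sine is `D / 2R`. -/
lemma exists_boatFactor_eq {K : Set Plane} (hK : IsCompact K) (hn : K.Nontrivial) :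
    ∃ s C : ℝ, boatFactor K = 1 + s ∧ 0 ≤ s ∧ s ^ 2 * (1 - C) = 2 ∧ 0 ≤ C ∧ C ≤ 1 / 2 ∧
      Metric.diam K ^ 2 = 4 * (1 - C ^ 2) * circumradius K ^ 2 := by
  have hD := diam_pos_of_nontrivial hK hn
  have hR := circumradius_pos hK hn
  have hDR := diam_le_two_mul_circumradius hK
  have hJ := three_mul_circumradius_sq_le hK
  unfold boatFactor
  set D := Metric.diam K
  set R := circumradius K
  have hle : (D / (2 * R)) ^ 2 ≤ 1 := by
    have : D / (2 * R) ≤ 1 := (div_le_one (by positivity)).2 hDR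
    have : 0 ≤ D / (2 * R) := by positivity
    nlinarith
  have hge : 3 / 4 ≤ (D / (2 * R)) ^ 2 := by
    rw [div_pow, le_div_iff₀ (by positivity)]; nlinarith
  set C := √(1 - (D / (2 * R)) ^ 2) with hC
  have hC2 : C ^ 2 = 1 - (D / (2 * R)) ^ 2 := Real.sq_sqrt (by linarith)
  have hC0 : 0 ≤ C := Real.sqrt_nonneg _
  have hDC : D ^ 2 = 4 * (1 - C ^ 2) * R ^ 2 := by rw [hC2]; field_simp; ring
  refine ⟨_, C, rfl, by positivity, ?_, hC0, by nlinarith, hDC⟩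
  rw [mul_pow, Real.sq_sqrt (by linarith), div_pow, mul_pow, mul_pow, Real.sq_sqrt (by norm_num),
    hDC]
  have h1 : 0 < 1 - C ^ 2 := by linarith
  field_simp
  ring

lemma boatFactor_le_three {K : Set Plane} (hK : IsCompact K) (hn : K.Nontrivial) :
    boatFactor K ≤ 3 := by
  obtain ⟨s, C, h, hs, hsC, hC0, hC, -⟩ := exists_boatFactor_eq hK hn
  rw [h]
  nlinarith

/-! ### The inequality for the width -/

/-- The point `q` lies in the open cone of `u₁`, `u₂` and the points `x`, `y` do not, so both lines
of sight meet the disk. Since `‖q‖ > r * s`, the bound `1 - 2 * (r / ‖q‖) ^ 2` exceeds `1 - 2 / s ^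
2 = C`. -/
lemma lt_cos_angle_of_contact {r s C : ℝ} {u₁ u₂ u₃ q x y : Plane} (hr : 0 ≤ r) (hs : 1 ≤ s)
    (hsC : s ^ 2 * (1 - C) = 2) (hu₁ : ‖u₁‖ = 1) (hu₂ : ‖u₂‖ = 1) (hu₃ : ‖u₃‖ = 1)
    {a₁ a₂ a₃ : ℝ} (ha₁ : 0 < a₁) (ha₂ : 0 < a₂) (ha₃ : 0 < a₃)
    (hsum : a₁ • u₁ + a₂ • u₂ + a₃ • u₃ = 0)
    (h₁₂ : 0 < cross u₁ u₂) (h₂₃ : 0 < cross u₂ u₃) (h₃₁ : 0 < cross u₃ u₁)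
    (hq₁ : inner ℝ u₁ q ≤ r) (hq₂ : inner ℝ u₂ q ≤ r) (hq₃ : inner ℝ u₃ q < -(r * s))
    (hx₁ : inner ℝ u₁ x ≤ r) (hx₂ : inner ℝ u₂ x ≤ r)
    (hy₁ : inner ℝ u₁ y ≤ r) (hy₂ : inner ℝ u₂ y ≤ r)
    (hx : ¬ (0 < cross u₁ x ∧ cross u₂ x < 0)) (hy : ¬ (0 < cross u₁ y ∧ cross u₂ y < 0)) :
    C < Real.cos (angle (x - q) (y - q)) ∧ x ≠ q ∧ y ≠ q := by
  have hrs : r ≤ r * s := by nlinarith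
  have c1 : 0 < cross u₁ q := by
    have := cross_pos_of_inner_lt (σ := 1) hr ha₁ ha₂ ha₃ hsum hu₁ hu₂ hu₃ hq₁ hq₂ (by linarith)
      (by linarith)
    linarith
  have c2 : cross u₂ q < 0 := by
    have := cross_pos_of_inner_lt (σ := -1) (u₁ := u₂) (u₂ := u₁) hr ha₂ ha₁ ha₃
      (by rw [← hsum]; abel) hu₂ hu₁ hu₃ hq₂ hq₁ (by linarith) (by rw [cross_swap]; linarith)
    linarith
  have hqn : r * s < ‖q‖ := by
    have := neg_le_of_abs_le (abs_real_inner_le_norm u₃ q)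
    rw [hu₃] at this
    linarith
  obtain ⟨z, hz, hzr⟩ := exists_mem_segment_norm_le hu₁ hu₂ h₁₂ c1 c2 hx hq₁ hq₂ hx₁ hx₂
  obtain ⟨z', hz', hzr'⟩ := exists_mem_segment_norm_le hu₁ hu₂ h₁₂ c1 c2 hy hq₁ hq₂ hy₁ hy₂
  refine ⟨?_, ?_, ?_⟩
  · refine lt_of_lt_of_le ?_ (le_cos_angle_of_segments_meet_ball hz hzr hz' hzr' (by linarith))
    have hq0 : 0 < ‖q‖ := by nlinarith
    have h1 : r / ‖q‖ * s < 1 := by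
      rw [div_mul_eq_mul_div, div_lt_one hq0]; exact hqn
    have h2 : 0 ≤ r / ‖q‖ := by positivity
    have h3 : (r / ‖q‖ * s) ^ 2 < 1 := by nlinarith [mul_nonneg h2 (by linarith : 0 ≤ s)]
    by_contra hcon
    rw [not_lt] at hcon
    nlinarith [mul_le_mul_of_nonneg_left hcon (sq_nonneg s)]
  · rintro rfl; exact hx ⟨c1, c2⟩
  · rintro rfl; exact hy ⟨c1, c2⟩

/-- A point of `K` seeing a diameter of `K` under a small angle forces a large circumradius. -/
lemma diam_sq_lt_of_lt_cos_angle {K : Set Plane} (hK : IsCompact K) (hn : K.Nontrivial)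
    {x y q : Plane} (hx : x ∈ K) (hy : y ∈ K) (hq : q ∈ K) (hxy : dist x y = Metric.diam K)
    (hxq : x ≠ q) (hyq : y ≠ q) {C : ℝ} (hC0 : 0 ≤ C)
    (hC : C < Real.cos (angle (x - q) (y - q))) :
    Metric.diam K ^ 2 < 4 * (1 - C ^ 2) * circumradius K ^ 2 := by
  have hD := diam_pos_of_nontrivial hK hn
  have hR := circumradius_pos hK hn
  set θ := angle (x - q) (y - q) with hθ
  set D := Metric.diam K with hDdef
  have ha : 0 < ‖x - q‖ := norm_pos_iff.2 (sub_ne_zero.2 hxq)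
  have hb : 0 < ‖y - q‖ := norm_pos_iff.2 (sub_ne_zero.2 hyq)
  have hab : ‖(x - q) - (y - q)‖ = D := by rw [sub_sub_sub_cancel_right, ← dist_eq_norm, hxy]
  have hP : Real.cos θ * (‖x - q‖ * ‖y - q‖) = inner ℝ (x - q) (y - q) :=
    cos_angle_mul_norm_mul_norm _ _
  have hS0 : 0 ≤ Real.sin θ := Real.sin_nonneg_of_nonneg_of_le_pi (angle_nonneg _ _) (angle_le_pi _ _)
  have hSC := Real.sin_sq_add_cos_sq θ
  have hρ : ∀ c ρ, 0 ≤ ρ → K ⊆ Metric.closedBall c ρ → D ≤ 2 * Real.sin θ * ρ := by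
    intro c ρ hρ0 hcK
    have hn : ∀ p ∈ K, ‖p - c‖ ≤ ρ := fun p hp => by
      rw [← dist_eq_norm]; exact hcK hp
    have h := circumradius_sq_mul_le (a := x - q) (b := y - q) (v := c - q) (ρ := ρ)
      (by rw [norm_sub_rev]; exact hn q hq)
      (by rw [sub_sub_sub_cancel_right]; exact hn x hx)
      (by rw [sub_sub_sub_cancel_right]; exact hn y hy)
      (by rw [← hP]; exact mul_nonneg (hC0.trans hC.le) (by positivity))
      (by rw [hab, ← dist_eq_norm]; exact Metric.dist_le_diam_of_mem hK.isBounded hx hq)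
      (by rw [hab, ← dist_eq_norm]; exact Metric.dist_le_diam_of_mem hK.isBounded hy hq)
    rw [hab, ← hP] at h
    have h2 : D ^ 2 ≤ (2 * Real.sin θ * ρ) ^ 2 := by
      have e : 4 * (‖x - q‖ ^ 2 * ‖y - q‖ ^ 2 - (Real.cos θ * (‖x - q‖ * ‖y - q‖)) ^ 2) * ρ ^ 2 =
          ‖x - q‖ ^ 2 * ‖y - q‖ ^ 2 * (2 * Real.sin θ * ρ) ^ 2 := by
        linear_combination (-4 * ‖x - q‖ ^ 2 * ‖y - q‖ ^ 2 * ρ ^ 2) * hSC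
      rw [e] at h
      exact le_of_mul_le_mul_left h (by positivity)
    exact abs_le_of_sq_le_sq' h2 (by positivity) |>.2
  -- A vanishing sine would force `D ≤ 0` when `hρ` is applied to any disk containing `K`.
  have hS : 0 < Real.sin θ := by
    rcases hS0.eq_or_lt with h | h
    · obtain ⟨ρ, hρ'⟩ := hK.isBounded.subset_closedBall 0
      have := hρ 0 (max ρ 0) (le_max_right _ _)
        (hρ'.trans (Metric.closedBall_subset_closedBall (le_max_left _ _)))
      rw [← h] at this
      linarith
    · exact h
  have hle : D / (2 * Real.sin θ) ≤ circumradius K :=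
    le_circumradius hK fun c ρ h0 h1 => by
      rw [div_le_iff₀ (by positivity)]
      linarith [hρ c ρ h0 h1]
  rw [div_le_iff₀ (by positivity)] at hle
  calc D ^ 2 ≤ (circumradius K * (2 * Real.sin θ)) ^ 2 := by gcongr
    _ = 4 * (1 - Real.cos θ ^ 2) * circumradius K ^ 2 := by rw [← hSC]; ring
    _ < 4 * (1 - C ^ 2) * circumradius K ^ 2 := by
      have : C ^ 2 < Real.cos θ ^ 2 := by gcongr
      have : 0 < circumradius K ^ 2 := by positivity
      nlinarith

/-- A pigeonhole argument: two diameter endpoints cannot occupy three disjoint cones, so the far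
point of a free cone sees the diameter under too small an angle. -/
lemma minWidth_le_of_contact {K : Set Plane} (hK : IsCompact K) (hn : K.Nontrivial)
    {r s C : ℝ} {c u₁ u₂ u₃ : Plane} (hr : 0 ≤ r) (hs : 1 ≤ s)
    (hsC : s ^ 2 * (1 - C) = 2) (hC0 : 0 ≤ C)
    (hDR : 4 * (1 - C ^ 2) * circumradius K ^ 2 ≤ Metric.diam K ^ 2)
    (hu₁ : ‖u₁‖ = 1) (hu₂ : ‖u₂‖ = 1) (hu₃ : ‖u₃‖ = 1)
    {a₁ a₂ a₃ : ℝ} (ha₁ : 0 < a₁) (ha₂ : 0 < a₂) (ha₃ : 0 < a₃)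
    (hsum : a₁ • u₁ + a₂ • u₂ + a₃ • u₃ = 0) (h₁₂ : 0 < cross u₁ u₂)
    (hK₁ : ∀ x ∈ K, inner ℝ u₁ (x - c) ≤ r) (hK₂ : ∀ x ∈ K, inner ℝ u₂ (x - c) ≤ r)
    (hK₃ : ∀ x ∈ K, inner ℝ u₃ (x - c) ≤ r) :
    minWidth K ≤ r * (1 + s) := by
  by_contra hcon
  rw [not_le] at hcon
  have hq : ∀ u : Plane, ‖u‖ = 1 → (∀ x ∈ K, inner ℝ u (x - c) ≤ r) →
      ∃ q ∈ K, inner ℝ u (q - c) < -(r * s) := by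
    intro u hu h
    obtain ⟨q, hqK, hq⟩ := exists_inner_lt_of_lt_minWidth hK hn.nonempty hu
      (M := r + inner ℝ u c) (fun x hx => by
        have := h x hx
        rw [inner_sub_right] at this; linarith) hcon
    refine ⟨q, hqK, ?_⟩
    rw [inner_sub_right]; linarith
  obtain ⟨q₁, hq₁, hq₁'⟩ := hq u₁ hu₁ hK₁
  obtain ⟨q₂, hq₂, hq₂'⟩ := hq u₂ hu₂ hK₂
  obtain ⟨q₃, hq₃, hq₃'⟩ := hq u₃ hu₃ hK₃
  obtain ⟨x, hx, y, hy, hxy⟩ := exists_dist_eq_diam_of_isCompact hK hn.nonempty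
  -- Taking cross products of the relation `hsum` with `u₁` and `u₂` shows that the three normals
  -- are positively oriented in cyclic order.
  have hcross : a₂ * cross u₁ u₂ = a₃ * cross u₃ u₁ ∧ a₃ * cross u₂ u₃ = a₁ * cross u₁ u₂ := by
    have e0 := congrArg (fun w : Plane => w 0) hsum
    have e1 := congrArg (fun w : Plane => w 1) hsum
    simp at e0 e1
    simp only [cross]
    constructor
    · linear_combination (u₁ 0) * e1 - (u₁ 1) * e0
    · linear_combination (u₂ 0) * e1 - (u₂ 1) * e0
  have h₃₁ : 0 < cross u₃ u₁ :=
    (mul_pos_iff_of_pos_left ha₃).1 (hcross.1 ▸ mul_pos ha₂ h₁₂)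
  have h₂₃ : 0 < cross u₂ u₃ :=
    (mul_pos_iff_of_pos_left ha₃).1 (hcross.2.symm ▸ mul_pos ha₁ h₁₂)
  have fin : ∀ q ∈ K, ¬ (C < Real.cos (angle ((x - c) - (q - c)) ((y - c) - (q - c))) ∧
      x - c ≠ q - c ∧ y - c ≠ q - c) := by
    rintro q hqK ⟨h1, h2, h3⟩
    rw [sub_sub_sub_cancel_right, sub_sub_sub_cancel_right] at h1
    have := diam_sq_lt_of_lt_cos_angle hK hn hx hy hqK hxy (by rintro rfl; exact h2 rfl)
      (by rintro rfl; exact h3 rfl) hC0 h1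
    linarith
  by_cases g₃ : ¬ (0 < cross u₁ (x - c) ∧ cross u₂ (x - c) < 0) ∧
      ¬ (0 < cross u₁ (y - c) ∧ cross u₂ (y - c) < 0)
  · exact fin q₃ hq₃ (lt_cos_angle_of_contact hr hs hsC hu₁ hu₂ hu₃ ha₁ ha₂ ha₃ hsum h₁₂ h₂₃ h₃₁
      (hK₁ _ hq₃) (hK₂ _ hq₃) hq₃' (hK₁ _ hx) (hK₂ _ hx) (hK₁ _ hy) (hK₂ _ hy) g₃.1 g₃.2)
  by_cases g₁ : ¬ (0 < cross u₂ (x - c) ∧ cross u₃ (x - c) < 0) ∧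
      ¬ (0 < cross u₂ (y - c) ∧ cross u₃ (y - c) < 0)
  · exact fin q₁ hq₁ (lt_cos_angle_of_contact hr hs hsC hu₂ hu₃ hu₁ ha₂ ha₃ ha₁
      (by rw [← hsum]; abel) h₂₃ h₃₁ h₁₂
      (hK₂ _ hq₁) (hK₃ _ hq₁) hq₁' (hK₂ _ hx) (hK₃ _ hx) (hK₂ _ hy) (hK₃ _ hy) g₁.1 g₁.2)
  by_cases g₂ : ¬ (0 < cross u₃ (x - c) ∧ cross u₁ (x - c) < 0) ∧
      ¬ (0 < cross u₃ (y - c) ∧ cross u₁ (y - c) < 0)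
  · exact fin q₂ hq₂ (lt_cos_angle_of_contact hr hs hsC hu₃ hu₁ hu₂ ha₃ ha₁ ha₂
      (by rw [← hsum]; abel) h₃₁ h₁₂ h₂₃
      (hK₃ _ hq₂) (hK₁ _ hq₂) hq₂' (hK₃ _ hx) (hK₁ _ hx) (hK₃ _ hy) (hK₁ _ hy) g₂.1 g₂.2)
  -- Each of the three cones would contain `x` or `y`, while the signs of the cross products make
  -- the cones pairwise disjoint.
  grind

lemma minWidth_le_of_antipodal {K : Set Plane} (hK : IsCompact K) (hne : K.Nonempty) {r : ℝ}
    {c u v : Plane} (hu : ‖u‖ = 1) (huv : u = -v) (hKu : ∀ x ∈ K, inner ℝ u (x - c) ≤ r)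
    (hKv : ∀ x ∈ K, inner ℝ v (x - c) ≤ r) : minWidth K ≤ 2 * r := by
  have := minWidth_le_of_inner_le hK hne hu (M := inner ℝ u c + r) (m := inner ℝ u c - r)
    (fun x hx => by have := hKu x hx; rw [inner_sub_right] at this; linarith)
    (fun x hx => by
      have := hKv x hx
      rw [show v = -u by rw [huv, neg_neg], inner_neg_left, inner_sub_right] at this
      linarith)
  linarith

lemma eq_neg_of_convex_combination_eq_zero {V : Type*} [NormedAddCommGroup V] [NormedSpace ℝ V]
    {u v : V} (hu : ‖u‖ = 1) (hv : ‖v‖ = 1) {a b : ℝ} (ha : 0 ≤ a) (hb : 0 ≤ b) (hab : a + b = 1)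
    (h : a • u + b • v = 0) : u = -v := by
  have h1 : a • u = -(b • v) := eq_neg_of_add_eq_zero_left h
  have h2 := congrArg norm h1
  rw [norm_neg, norm_smul, norm_smul, hu, hv, Real.norm_of_nonneg ha, Real.norm_of_nonneg hb,
    mul_one, mul_one] at h2
  have h3 : a = 1 / 2 := by linarith
  rw [← h2, h3, ← smul_neg] at h1
  exact smul_right_injective V (by norm_num : (1 / 2 : ℝ) ≠ 0) h1

lemma eq_of_cross_eq_zero {u v : Plane} (hu : ‖u‖ = 1) (hv : ‖v‖ = 1) (h : cross u v = 0)
    (hne : u ≠ -v) : u = v := by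
  have h1 := norm_sq_eq_inner_add_cross hu v
  rw [h, hv] at h1
  have h2 : (inner ℝ u v - 1) * (inner ℝ u v + 1) = 0 := by linarith
  rcases mul_eq_zero.1 h2 with h3 | h3
  · exact (inner_eq_one_iff_of_norm_eq_one (𝕜 := ℝ) hu hv).1 (by linarith)
  · exfalso
    apply hne
    rw [← inner_eq_one_iff_of_norm_eq_one (𝕜 := ℝ) hu (by rwa [norm_neg]), inner_neg_right]
    linarith

theorem minWidth_le_inradius_mul_boatFactor {K : Set Plane} (hK : IsConvexBody K)
    (hn : K.Nontrivial) : minWidth K ≤ inradius K * boatFactor K := by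
  have hKc := hK.isCompact
  obtain ⟨s, C, hF, hs0, hsC, hC0, hC, hDC⟩ := exists_boatFactor_eq hKc hn
  have hs : 1 ≤ s := by nlinarith
  obtain ⟨c, hc⟩ := exists_closedBall_inradius_subset hKc hK.nonempty
  have hr := inradius_nonneg K
  obtain ⟨u, a, hu, ha, ha1, hau⟩ := exists_three_of_mem_convexHull
    (zero_mem_convexHull_contact_normals hK hr hc fun c' r' h0 h1 => le_inradius hKc h0 h1)
  rw [hF]
  by_contra hcon
  -- Opposite normals bound the width by `2 * r`, which is enough because `1 ≤ s`. This also
  -- excludes zero weights and parallel normals below.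
  have hno : ∀ i j, u i ≠ -u j := fun i j h => by
    have := minWidth_le_of_antipodal hKc hK.nonempty (hu i).1 h (hu i).2 (hu j).2
    nlinarith
  rw [Fin.sum_univ_three] at ha1 hau
  have ha0 : ∀ i, 0 < a i := by
    intro i
    rcases (ha i).eq_or_lt with h | h
    · exfalso
      fin_cases i
      · simp only [Fin.zero_eta] at h
        rw [← h, zero_smul, zero_add] at hau
        exact hno 1 2 (eq_neg_of_convex_combination_eq_zero (hu 1).1 (hu 2).1 (ha 1) (ha 2)
          (by linarith) hau)
      · simp only [Fin.mk_one] at h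
        rw [← h, zero_smul, add_zero] at hau
        exact hno 0 2 (eq_neg_of_convex_combination_eq_zero (hu 0).1 (hu 2).1 (ha 0) (ha 2)
          (by linarith) hau)
      · simp only [Fin.reduceFinMk] at h
        rw [← h, zero_smul, add_zero] at hau
        exact hno 0 1 (eq_neg_of_convex_combination_eq_zero (hu 0).1 (hu 1).1 (ha 0) (ha 1)
          (by linarith) hau)
    · exact h
  rcases lt_trichotomy (cross (u 0) (u 1)) 0 with h | h | h
  · exact hcon (minWidth_le_of_contact hKc hn hr hs hsC hC0 hDC.ge (hu 1).1 (hu 0).1 (hu 2).1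
      (ha0 1) (ha0 0) (ha0 2) (by rw [← hau]; abel) (by rw [cross_swap]; linarith)
      (hu 1).2 (hu 0).2 (hu 2).2)
  · have h01 : u 0 = u 1 := eq_of_cross_eq_zero (hu 0).1 (hu 1).1 h (hno 0 1)
    rw [← h01, ← add_smul] at hau
    exact hno 0 2 (eq_neg_of_convex_combination_eq_zero (hu 0).1 (hu 2).1
      (add_nonneg (ha 0) (ha 1)) (ha 2) ha1 hau)
  · exact hcon (minWidth_le_of_contact hKc hn hr hs hsC hC0 hDC.ge (hu 0).1 (hu 1).1 (hu 2).1
      (ha0 0) (ha0 1) (ha0 2) hau h (hu 0).2 (hu 1).2 (hu 2).2)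

/-! ### Orthonormal frames adapted to an isosceles triangle -/

/-- The point with coordinates `s`, `t` with respect to the origin `o` and the vectors `m`, `n`. -/
def framePt (o m n : Plane) (s t : ℝ) : Plane := o + s • m + t • n

/-- `m`, `n` are orthonormal, `R` is positive, and `a`, `b` are the sine and the cosine of an angle
in `[π / 6, π / 4]`. -/
structure IsBoatFrame (m n : Plane) (R a b : ℝ) : Prop where
  norm_m : ‖m‖ = 1
  norm_n : ‖n‖ = 1
  inner_mn : inner ℝ m n = 0
  R_pos : 0 < R
  half_le : 1 / 2 ≤ a
  le : a ≤ b
  sq_add_sq : a ^ 2 + b ^ 2 = 1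

namespace IsBoatFrame

variable {o m n : Plane} {R a b : ℝ}

lemma a_pos (h : IsBoatFrame m n R a b) : 0 < a := by linarith [h.half_le]

lemma b_pos (h : IsBoatFrame m n R a b) : 0 < b := h.a_pos.trans_le h.le

lemma a_lt_one (h : IsBoatFrame m n R a b) : a < 1 := by
  nlinarith [h.sq_add_sq, h.b_pos, h.a_pos]

end IsBoatFrame

lemma eq_inner_smul_add_inner_smul {m n : Plane} (hm : ‖m‖ = 1) (hn : ‖n‖ = 1)
    (hmn : inner ℝ m n = 0) (v : Plane) : v = inner ℝ m v • m + inner ℝ n v • n := by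
  have h1 := Plane.norm_sq_eq m
  have h2 := Plane.norm_sq_eq n
  have h3 := norm_sq_eq_inner_add_cross hm n
  rw [hm] at h1
  rw [hn] at h2
  rw [hn, hmn] at h3
  have hδ : cross m n ≠ 0 := by
    intro h0
    rw [h0] at h3
    norm_num at h3
  set w := v - (inner ℝ m v • m + inner ℝ n v • n) with hw
  have e1 : inner ℝ m w = 0 := by
    rw [hw, inner_sub_right, inner_add_right, inner_smul_right, inner_smul_right, hmn,
      real_inner_self_eq_norm_sq, hm]
    ring
  have e2 : inner ℝ n w = 0 := by
    rw [hw, inner_sub_right, inner_add_right, inner_smul_right, inner_smul_right,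
      real_inner_comm m n, hmn, real_inner_self_eq_norm_sq, hn]
    ring
  rw [Plane.inner_eq] at e1 e2
  have e3 : w = 0 := by
    ext i
    fin_cases i
    · have : cross m n * w 0 = 0 := by
        simp only [cross]
        linear_combination n 1 * e1 - m 1 * e2
      simpa [hδ] using this
    · have : cross m n * w 1 = 0 := by
        simp only [cross]
        linear_combination m 0 * e2 - n 0 * e1
      simpa [hδ] using this
  exact sub_eq_zero.1 e3

namespace IsBoatFrame

variable {o m n : Plane} {R a b : ℝ}

lemma norm_smul_add_smul_sq (h : IsBoatFrame m n R a b) (s t : ℝ) :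
    ‖s • m + t • n‖ ^ 2 = s ^ 2 + t ^ 2 := by
  rw [norm_add_sq_real, norm_smul, norm_smul, h.norm_m, h.norm_n, real_inner_smul_left,
    inner_smul_right, h.inner_mn, mul_one, mul_one, Real.norm_eq_abs, Real.norm_eq_abs, sq_abs,
    sq_abs]
  ring

lemma inner_sq_add_inner_sq (h : IsBoatFrame m n R a b) (v : Plane) :
    inner ℝ m v ^ 2 + inner ℝ n v ^ 2 = ‖v‖ ^ 2 := by
  conv_rhs => rw [eq_inner_smul_add_inner_smul h.norm_m h.norm_n h.inner_mn v]
  rw [h.norm_smul_add_smul_sq]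

lemma framePt_mem_closedBall (h : IsBoatFrame m n R a b) {s t : ℝ}
    (hst : s ^ 2 + t ^ 2 ≤ R ^ 2) : framePt o m n s t ∈ Metric.closedBall o R := by
  rw [Metric.mem_closedBall, dist_eq_norm, framePt, add_assoc, add_sub_cancel_left]
  refine (abs_le_of_sq_le_sq' ?_ h.R_pos.le).2
  rwa [h.norm_smul_add_smul_sq]

/-! ### The isosceles triangle in its frame, and its inradius. -/

/-- The apex of the triangle. -/
def apex (o m n : Plane) (R : ℝ) : Plane := framePt o m n R 0

/-- The left base point of the triangle. -/
def base₁ (o m n : Plane) (R a b : ℝ) : Plane :=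
  framePt o m n (-(R * (b ^ 2 - a ^ 2))) (2 * R * a * b)

/-- The right base point of the triangle. -/
def base₂ (o m n : Plane) (R a b : ℝ) : Plane :=
  framePt o m n (-(R * (b ^ 2 - a ^ 2))) (-(2 * R * a * b))

/-- The legs make with the axis an angle of tangent `a / b`, so the hypotheses describe the base and
the two legs. The weights `w₁`, `w₂`, `w₃` are the barycentric coordinates of the point. -/
lemma framePt_mem_triangle (h : IsBoatFrame m n R a b) {s t : ℝ}
    (hs : R - 2 * R * b ^ 2 ≤ s) (ht : |t| * b ≤ (R - s) * a) :
    framePt o m n s t ∈ triangle (base₁ o m n R a b) (base₂ o m n R a b) (apex o m n R) := by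
  have hR := h.R_pos
  have ha := h.a_pos
  have hb := h.b_pos
  have hab := h.sq_add_sq
  obtain ⟨ht1, ht2⟩ := abs_le.1 (show |t| ≤ (R - s) * a / b by rwa [le_div_iff₀ hb])
  rw [← neg_div, div_le_iff₀ hb] at ht1
  rw [le_div_iff₀ hb] at ht2
  set w₁ := ((R - s) * a + t * b) / (4 * R * a * b ^ 2) with hw₁
  set w₂ := ((R - s) * a - t * b) / (4 * R * a * b ^ 2) with hw₂
  set w₃ := (s - (R - 2 * R * b ^ 2)) / (2 * R * b ^ 2) with hw₃
  have h1 : 0 ≤ w₁ := div_nonneg (by linarith) (by positivity)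
  have h2 : 0 ≤ w₂ := div_nonneg (by linarith) (by positivity)
  have h3 : 0 ≤ w₃ := div_nonneg (by linarith) (by positivity)
  have hsum : w₁ + w₂ + w₃ = 1 := by
    rw [hw₁, hw₂, hw₃]; field_simp; ring
  have hmem := (convex_convexHull ℝ ({base₁ o m n R a b, base₂ o m n R a b, apex o m n R} :
    Set Plane)).sum_mem (t := Finset.univ) (w := ![w₁, w₂, w₃])
    (z := ![base₁ o m n R a b, base₂ o m n R a b, apex o m n R])
    (by intro i _; fin_cases i <;> simpa)
    (by simpa [Fin.sum_univ_three] using hsum)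
    (by intro i _; apply subset_convexHull; fin_cases i <;> simp)
  have hs' : w₁ * (-(R * (b ^ 2 - a ^ 2))) + w₂ * (-(R * (b ^ 2 - a ^ 2))) + w₃ * R = s := by
    have ha2 : a ^ 2 = 1 - b ^ 2 := by linarith
    rw [ha2, hw₁, hw₂, hw₃]; field_simp; ring
  have ht' : w₁ * (2 * R * a * b) - w₂ * (2 * R * a * b) = t := by
    rw [hw₁, hw₂]; field_simp; ring
  unfold triangle
  convert hmem using 1
  rw [Fin.sum_univ_three]
  simp only [Matrix.cons_val_zero, Matrix.cons_val_one, Matrix.cons_val, framePt, base₁, base₂,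
    apex]
  rw [← hs', ← ht']
  nth_rewrite 1 [← one_smul ℝ o]
  rw [← hsum]
  module

lemma inner_m_framePt_sub (h : IsBoatFrame m n R a b) (s t s' t' : ℝ) :
    inner ℝ m (framePt o m n s t - framePt o m n s' t') = s - s' := by
  rw [show framePt o m n s t - framePt o m n s' t' = (s - s') • m + (t - t') • n by
    simp only [framePt]; module]
  rw [inner_add_right, inner_smul_right, inner_smul_right, h.inner_mn, real_inner_self_eq_norm_sq,
    h.norm_m]
  ring

lemma inner_n_framePt_sub (h : IsBoatFrame m n R a b) (s t s' t' : ℝ) :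
    inner ℝ n (framePt o m n s t - framePt o m n s' t') = t - t' := by
  rw [show framePt o m n s t - framePt o m n s' t' = (s - s') • m + (t - t') • n by
    simp only [framePt]; module]
  rw [inner_add_right, inner_smul_right, inner_smul_right, real_inner_comm m n, h.inner_mn,
    real_inner_self_eq_norm_sq, h.norm_n]
  ring

/-- The triangle lies in the three half-planes bounded by its edges. -/
lemma inner_le_of_mem_triangle (h : IsBoatFrame m n R a b) {v : Plane}
    (hv : v ∈ triangle (base₁ o m n R a b) (base₂ o m n R a b) (apex o m n R)) :
    inner ℝ (a • m + b • n) (v - apex o m n R) ≤ 0 ∧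
      inner ℝ (a • m + (-b) • n) (v - apex o m n R) ≤ 0 ∧
      -inner ℝ m (v - apex o m n R) ≤ 2 * R * b ^ 2 := by
  have hR := h.R_pos
  have ha := h.a_pos
  have hb := h.b_pos
  have hab := h.sq_add_sq
  have key : ∀ (w : Plane) (M : ℝ), inner ℝ w (base₁ o m n R a b - apex o m n R) ≤ M →
      inner ℝ w (base₂ o m n R a b - apex o m n R) ≤ M → 0 ≤ M →
      inner ℝ w (v - apex o m n R) ≤ M := by
    intro w M h1 h2 h3
    have hconv : Convex ℝ {y : Plane | inner ℝ w y ≤ M + inner ℝ w (apex o m n R)} :=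
      convex_halfSpace_le (innerSL ℝ w).isLinear _
    have hsub : triangle (base₁ o m n R a b) (base₂ o m n R a b) (apex o m n R) ⊆
        {y : Plane | inner ℝ w y ≤ M + inner ℝ w (apex o m n R)} := by
      refine convexHull_min ?_ hconv
      rintro y (rfl | rfl | rfl)
      · rw [inner_sub_right] at h1; simp only [Set.mem_ofPred_eq]; linarith
      · rw [inner_sub_right] at h2; simp only [Set.mem_ofPred_eq]; linarith
      · simp only [Set.mem_ofPred_eq]; linarith
    have := hsub hv
    simp only [Set.mem_ofPred_eq] at this
    rw [inner_sub_right]; linarith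
  have m1 : inner ℝ m (base₁ o m n R a b - apex o m n R) = -(2 * R * b ^ 2) := by
    rw [base₁, apex, h.inner_m_framePt_sub]; linear_combination R * hab
  have m2 : inner ℝ m (base₂ o m n R a b - apex o m n R) = -(2 * R * b ^ 2) := by
    rw [base₂, apex, h.inner_m_framePt_sub]; linear_combination R * hab
  have n1 : inner ℝ n (base₁ o m n R a b - apex o m n R) = 2 * R * a * b := by
    rw [base₁, apex, h.inner_n_framePt_sub]; ring
  have n2 : inner ℝ n (base₂ o m n R a b - apex o m n R) = -(2 * R * a * b) := by
    rw [base₂, apex, h.inner_n_framePt_sub]; ring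
  have hpos : 0 < R * a * b ^ 2 := by positivity
  refine ⟨key _ 0 ?_ ?_ le_rfl, key _ 0 ?_ ?_ le_rfl, ?_⟩
  · rw [inner_add_left, real_inner_smul_left, real_inner_smul_left, m1, n1]; nlinarith
  · rw [inner_add_left, real_inner_smul_left, real_inner_smul_left, m2, n2]; nlinarith
  · rw [inner_add_left, real_inner_smul_left, real_inner_smul_left, m1, n1]; nlinarith
  · rw [inner_add_left, real_inner_smul_left, real_inner_smul_left, m2, n2]; nlinarith
  · rw [← inner_neg_left]
    refine key _ _ ?_ ?_ (by positivity)
    · rw [inner_neg_left, m1, neg_neg]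
    · rw [inner_neg_left, m2, neg_neg]

/-- Test the half-planes at the points of the disk extreme in the three outward normal directions.
Adding the two inequalities for the legs eliminates the component along `n`. -/
lemma le_of_closedBall_subset_triangle (h : IsBoatFrame m n R a b) {c : Plane} {ρ : ℝ}
    (hρ : 0 ≤ ρ) (hc : Metric.closedBall c ρ ⊆
      triangle (base₁ o m n R a b) (base₂ o m n R a b) (apex o m n R)) :
    ρ ≤ -(a * inner ℝ m (c - apex o m n R)) ∧
      ρ - inner ℝ m (c - apex o m n R) ≤ 2 * R * b ^ 2 := by
  have hball : ∀ u : Plane, ‖u‖ = 1 → c + ρ • u ∈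
      triangle (base₁ o m n R a b) (base₂ o m n R a b) (apex o m n R) := fun u hu => hc (by
    simp [norm_smul, hu, abs_of_nonneg hρ])
  have key : ∀ w u : Plane, inner ℝ w (c + ρ • u - apex o m n R) =
      inner ℝ w (c - apex o m n R) + ρ * inner ℝ w u := by
    intro w u
    rw [show c + ρ • u - apex o m n R = (c - apex o m n R) + ρ • u by abel, inner_add_right,
      inner_smul_right]
  have hu : ∀ b' : ℝ, b' ^ 2 = b ^ 2 → ‖a • m + b' • n‖ = 1 := by
    intro b' hb'
    have := h.norm_smul_add_smul_sq a b'
    rw [hb', h.sq_add_sq] at this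
    exact (pow_eq_one_iff_of_nonneg (norm_nonneg _) two_ne_zero).1 this
  have e1 := (h.inner_le_of_mem_triangle (hball _ (hu b rfl))).1
  have e2 := (h.inner_le_of_mem_triangle (hball _ (hu (-b) (by ring)))).2.1
  have e3 := (h.inner_le_of_mem_triangle (hball (-m) (by rw [norm_neg, h.norm_m]))).2.2
  rw [key, real_inner_self_eq_norm_sq, hu b rfl, inner_add_left, real_inner_smul_left,
    real_inner_smul_left] at e1
  rw [key, real_inner_self_eq_norm_sq, hu (-b) (by ring), inner_add_left, real_inner_smul_left,
    real_inner_smul_left] at e2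
  rw [key, inner_neg_right, real_inner_self_eq_norm_sq, h.norm_m] at e3
  constructor <;> linarith

lemma isCompact_triangle (p₁ p₂ p₃ : Plane) : IsCompact (triangle p₁ p₂ p₃) :=
  Set.Finite.isCompact_convexHull ℝ (Set.toFinite _)

lemma inradius_triangle (h : IsBoatFrame m n R a b) :
    inradius (triangle (base₁ o m n R a b) (base₂ o m n R a b) (apex o m n R)) =
      2 * R * a * (1 - a) := by
  have hR := h.R_pos
  have ha := h.a_pos
  have hb := h.b_pos
  have hab := h.sq_add_sq
  have ha1 := h.a_lt_one
  have hρ : 0 ≤ 2 * R * a * (1 - a) := mul_nonneg (by positivity) (by linarith)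
  apply le_antisymm
  · refine inradius_le hρ fun c ρ h0 h1 => ?_
    obtain ⟨e1, e2⟩ := h.le_of_closedBall_subset_triangle h0 h1
    have e3 : (1 + a) * ρ ≤ (1 + a) * (2 * R * a * (1 - a)) := by
      have : b ^ 2 = (1 - a) * (1 + a) := by linear_combination hab
      rw [this] at e2
      nlinarith [mul_le_mul_of_nonneg_left e2 ha.le]
    exact le_of_mul_le_mul_left e3 (by linarith)
  -- The incenter: on the axis, at distance `2 * R * (1 - a)` from the apex.
  · refine le_inradius (isCompact_triangle _ _ _) (c := framePt o m n (R * (2 * a - 1)) 0) hρ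
      fun v hv => ?_
    rw [Metric.mem_closedBall, dist_eq_norm] at hv
    set w := v - framePt o m n (R * (2 * a - 1)) 0 with hw
    have e : v = framePt o m n (R * (2 * a - 1) + inner ℝ m w) (inner ℝ n w) := by
      have := eq_inner_smul_add_inner_smul h.norm_m h.norm_n h.inner_mn w
      have hv' : v = framePt o m n (R * (2 * a - 1)) 0 + w := by rw [hw]; abel
      nth_rewrite 1 [hv', this]
      simp only [framePt]; module
    have hw2 : inner ℝ m w ^ 2 + inner ℝ n w ^ 2 ≤ (2 * R * a * (1 - a)) ^ 2 := by
      rw [h.inner_sq_add_inner_sq]; gcongr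
    rw [e]
    apply h.framePt_mem_triangle
    · have := (abs_le_of_sq_le_sq' (show inner ℝ m w ^ 2 ≤ (2 * R * a * (1 - a)) ^ 2 by
        nlinarith [sq_nonneg (inner ℝ n w)]) hρ).1
      nlinarith
    -- Cauchy–Schwarz against the unit vector with components `a`, `b` keeps the disk between the
    -- legs.
    · have e1 : (|inner ℝ n w| * b + a * inner ℝ m w) ^ 2 ≤ (2 * R * a * (1 - a)) ^ 2 := by
        have := sq_abs (inner ℝ n w)
        have e2 : (|inner ℝ n w| * b + a * inner ℝ m w) ^ 2 +
            (|inner ℝ n w| * a - b * inner ℝ m w) ^ 2 =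
            inner ℝ m w ^ 2 + inner ℝ n w ^ 2 := by
          rw [← this]; linear_combination (|inner ℝ n w| ^ 2 + inner ℝ m w ^ 2) * hab
        nlinarith [sq_nonneg (|inner ℝ n w| * a - b * inner ℝ m w)]
      have := (abs_le_of_sq_le_sq' e1 hρ).2
      nlinarith

end IsBoatFrame

/-! ### Scaling of the inradius, and the trigonometric core of the width bound. -/

/-- The inradius of a set contained in the image of a compact set under a similarity. -/
lemma inradius_le_of_subset_image {S K : Set Plane} (hK : IsCompact K) {p q : Plane} {l : ℝ}
    (hl : 0 < l) (hS : S ⊆ (fun x : Plane => p + l • (x - q)) '' K) :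
    inradius S ≤ l * inradius K := by
  refine inradius_le (mul_nonneg hl.le (inradius_nonneg K)) fun c ρ h0 h1 => ?_
  rw [← div_le_iff₀' hl]
  refine le_inradius hK (c := q + l⁻¹ • (c - p)) (by positivity) fun y hy => ?_
  obtain ⟨z, hz, hzy⟩ := hS (h1 (show p + l • (y - q) ∈ Metric.closedBall c ρ by
    rw [Metric.mem_closedBall, dist_eq_norm] at hy ⊢
    have e : p + l • (y - q) - c = l • (y - (q + l⁻¹ • (c - p))) := by
      have : l • l⁻¹ • (c - p) = c - p := smul_inv_smul₀ hl.ne' _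
      rw [← sub_sub, smul_sub l (y - q), this]; abel
    rw [e, norm_smul, Real.norm_of_nonneg hl.le]
    calc l * _ ≤ l * (ρ / l) := by gcongr
      _ = ρ := by field_simp))
  have : z - q = y - q := smul_right_injective Plane hl.ne' (add_left_cancel hzy)
  rwa [sub_left_inj.1 this] at hz

/-- The numerical core of the lower bound for the width of a boat: `W` bounds the breadths between
points of the boat of circumradius `1` in a direction with components `Y` and `X`. -/
lemma one_add_le_of_forall_breadth_le {a b β X Y W : ℝ} (hhalf : 1 / 2 ≤ a) (hle : a ≤ b)
    (hab : a ^ 2 + b ^ 2 = 1) (hβk : b ^ 2 - a ^ 2 ≤ β) (hβa : β ≤ a) (hX0 : 0 ≤ X) (hY0 : 0 ≤ Y)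
    (hXY : Y ^ 2 + X ^ 2 = 1)
    (hW : ∀ s₁ t₁ s₂ t₂ : ℝ, -β ≤ s₁ → |t₁| * b ≤ (1 - s₁) * a → s₁ ^ 2 + t₁ ^ 2 ≤ 1 →
      -β ≤ s₂ → |t₂| * b ≤ (1 - s₂) * a → s₂ ^ 2 + t₂ ^ 2 ≤ 1 →
      (s₁ - s₂) * Y + (t₁ - t₂) * X ≤ W) : 1 + β ≤ W := by
  have ha : 0 < a := by linarith
  have hb : 0 < b := by linarith
  have hk0 : 0 ≤ b ^ 2 - a ^ 2 := by nlinarith only [hle, ha]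
  have ha1 : a < 1 := by nlinarith only [hab, hb, hle, ha]
  have hβ0 : 0 ≤ β := hk0.trans hβk
  -- The arc of the circle cut off by the base of the inscribed triangle lies between the extended
  -- legs.
  have hcone : ∀ s t : ℝ, 0 ≤ t → s ^ 2 + t ^ 2 = 1 → s ≤ 1 → b ^ 2 - a ^ 2 ≤ -s →
      |(-t)| * b ≤ (1 - s) * a := by
    intro s t ht hst hs1 hs
    rw [abs_neg, abs_of_nonneg ht]
    refine (abs_le_of_sq_le_sq' ?_ (mul_nonneg (by linarith) ha.le)).2
    have e1 : (t * b) ^ 2 = (1 - s) * ((1 + s) * b ^ 2) := by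
      linear_combination b ^ 2 * hst
    have e2 : ((1 - s) * a) ^ 2 = (1 - s) * ((1 - s) * a ^ 2) := by ring
    have e3 : (1 + s) * b ^ 2 - (1 - s) * a ^ 2 = b ^ 2 - a ^ 2 + s := by
      linear_combination s * hab
    rw [e1, e2]
    exact mul_le_mul_of_nonneg_left (by linarith) (by linarith)
  have hbase : |(2 * a * b)| * b ≤ (1 - (-(b ^ 2 - a ^ 2))) * a := by
    rw [abs_of_pos (by positivity)]
    apply le_of_eq
    linear_combination a * hab
  have hbase' : (-(b ^ 2 - a ^ 2)) ^ 2 + (2 * a * b) ^ 2 ≤ 1 := by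
    apply le_of_eq
    linear_combination (a ^ 2 + b ^ 2 + 1) * hab
  -- Steep directions: compare the apex with an end of the chord at level `-β`.
  rcases le_or_gt β Y with hY | hY
  · have hβ1 : 0 ≤ 1 - β ^ 2 := by nlinarith only [hβ0, hβa, ha1]
    obtain ⟨e, he⟩ : ∃ e, e = √(1 - β ^ 2) := ⟨_, rfl⟩
    have he0 : 0 ≤ e := he ▸ Real.sqrt_nonneg _
    have he2 : e ^ 2 = 1 - β ^ 2 := he ▸ Real.sq_sqrt hβ1
    have hY1 : Y ≤ 1 := by nlinarith only [hXY, hY0, sq_nonneg X]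
    have := hW 1 0 (-β) (-e) (by linarith) (by simp) (by simp) le_rfl
      (hcone _ _ he0 (by rw [he2]; ring) (by linarith) (by linarith))
      (by rw [neg_sq, neg_sq, he2]; linarith)
    refine le_trans ?_ this
    have h1 : (1 + β) * (1 - Y) ≤ e * X := by
      refine (abs_le_of_sq_le_sq' ?_ (mul_nonneg he0 hX0)).2
      have e1 : (e * X) ^ 2 = ((1 + β) * (1 - Y)) * ((1 - β) * (1 + Y)) := by
        rw [mul_pow, he2, show X ^ 2 = 1 - Y ^ 2 by linarith]; ring
      rw [e1, sq]
      exact mul_le_mul_of_nonneg_left (by linarith) (mul_nonneg (by linarith) (by linarith))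
    linarith
  -- Intermediate directions: compare a base vertex with the point of the circle in the direction
  -- opposite to `(Y, X)`. The breadth is then at least `1 + a`.
  rcases le_or_gt (b ^ 2 - a ^ 2) Y with hY' | hY'
  · have := hW (-(b ^ 2 - a ^ 2)) (2 * a * b) (-Y) (-X) (by linarith) hbase hbase'
      (by linarith) (hcone _ _ hX0 (by rw [neg_sq]; exact hXY) (by linarith) (by linarith))
      (by rw [neg_sq, neg_sq]; exact hXY.le)
    refine le_trans ?_ this
    have hXb : b ≤ X := by
      refine (abs_le_of_sq_le_sq' ?_ hX0).2
      nlinarith only [hY, hβa, hY0, hXY, hab]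
    have h1 : (b ^ 2 - a ^ 2) * Y ≤ (b ^ 2 - a ^ 2) * a := by gcongr; linarith
    have h2 : 2 * a * b * b ≤ 2 * a * b * X := by gcongr
    have h3 : 2 * a * b * b - (b ^ 2 - a ^ 2) * a = a := by linear_combination a * hab
    linarith
  -- Flat directions: compare the two base vertices. The breadth is at least `8 * a ^ 2 * b ^ 2`,
  -- and `1 / 2 ≤ a` (an apex angle of at least π/3) makes this at least `1 + a`.
  · have := hW (-(b ^ 2 - a ^ 2)) (2 * a * b) (-(b ^ 2 - a ^ 2)) (-(2 * a * b)) (by linarith)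
      hbase hbase' (by linarith) (by rwa [abs_neg]) (by rwa [neg_sq (2 * a * b)])
    refine le_trans ?_ this
    have hX2 : (2 * a * b) ^ 2 ≤ X ^ 2 := by nlinarith only [hY', hY0, hXY, hbase', hk0]
    have hXab : 2 * a * b ≤ X := (abs_le_of_sq_le_sq' hX2 hX0).2
    have h1 : (2 * a * b) * (2 * a * b) ≤ (2 * a * b) * X := by gcongr
    have h2 : 1 + a ≤ 8 * a ^ 2 * b ^ 2 := by
      rw [show b ^ 2 = (1 - a) * (1 + a) by linear_combination hab]
      have h3 : 0 ≤ 1 + 2 * a - 4 * a ^ 2 := by nlinarith only [hle, ha, hab, hhalf]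
      have : 0 ≤ (1 + a) * ((2 * a - 1) * (1 + 2 * a - 4 * a ^ 2)) :=
        mul_nonneg (by linarith) (mul_nonneg (by linarith) h3)
      linarith
    linarith

/-! ### Inradius, factor and width of the boats. -/

namespace IsBoatFrame

variable {o m n : Plane} {R a b : ℝ}

/-- A point of the disk above the base and between the legs of the scaled triangle, whose height is
`r * (1 + a) / a`, belongs to the boat. -/
lemma framePt_mem_boat (h : IsBoatFrame m n R a b) {r s t : ℝ} (hr : 0 < r)
    (hs : R * a - r * (1 + a) ≤ s * a) (ht : |t| * b ≤ (R - s) * a) (hst : s ^ 2 + t ^ 2 ≤ R ^ 2) :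
    framePt o m n s t ∈
      boat o R (base₁ o m n R a b) (base₂ o m n R a b) (apex o m n R) r := by
  have hR := h.R_pos
  have ha := h.a_pos
  have ha1 : 0 < 1 - a := by linarith [h.a_lt_one]
  have hab := h.sq_add_sq
  refine ⟨?_, h.framePt_mem_closedBall hst⟩
  rw [h.inradius_triangle]
  set l := r / (2 * R * a * (1 - a)) with hl
  have hl0 : 0 < l := by positivity
  refine ⟨framePt o m n (R + (s - R) / l) (t / l), h.framePt_mem_triangle ?_ ?_, ?_⟩
  · have h1 : (R - s) / l ≤ 2 * R * b ^ 2 := by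
      rw [div_le_iff₀ hl0, hl, mul_div_assoc', le_div_iff₀ (by positivity),
        show b ^ 2 = (1 - a) * (1 + a) by linear_combination hab]
      have : (R - s) * a ≤ r * (1 + a) := by linarith
      nlinarith [mul_le_mul_of_nonneg_left this (by positivity : 0 ≤ 2 * R * (1 - a))]
    have h2 : (s - R) / l = -((R - s) / l) := by rw [← neg_div, neg_sub]
    rw [h2]; linarith
  · rw [abs_div, abs_of_pos hl0]
    have h2 : (R - (R + (s - R) / l)) * a = (R - s) * a / l := by ring
    rw [h2, div_mul_eq_mul_div]
    gcongr
  · rw [AffineMap.homothety_apply, vsub_eq_sub, vadd_eq_add]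
    have e : framePt o m n (R + (s - R) / l) (t / l) - apex o m n R =
        l⁻¹ • ((s - R) • m + t • n) := by
      simp only [apex, framePt, div_eq_inv_mul]
      module
    rw [e, smul_inv_smul₀ hl0.ne']
    simp only [apex, framePt]
    module

lemma isCompact_boat (o : Plane) (R : ℝ) (p₁ p₂ p₃ : Plane) (r : ℝ) :
    IsCompact (boat o R p₁ p₂ p₃ r) :=
  ((isCompact_triangle p₁ p₂ p₃).image (AffineMap.continuous_of_finiteDimensional _)).inter
    (isCompact_closedBall o R)

lemma convex_boat (o : Plane) (R : ℝ) (p₁ p₂ p₃ : Plane) (r : ℝ) :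
    Convex ℝ (boat o R p₁ p₂ p₃ r) :=
  ((convex_convexHull ℝ _).affine_image _).inter (convex_closedBall o R)

lemma inradius_boat_le (h : IsBoatFrame m n R a b) {r : ℝ} (hr : 0 < r) :
    inradius (boat o R (base₁ o m n R a b) (base₂ o m n R a b) (apex o m n R) r) ≤ r := by
  have hR := h.R_pos
  have ha := h.a_pos
  have ha1 : 0 < 1 - a := by linarith [h.a_lt_one]
  have hI := h.inradius_triangle (o := o)
  have hpos : 0 < 2 * R * a * (1 - a) := by positivity
  have := inradius_le_of_subset_image (p := apex o m n R) (q := apex o m n R)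
    (S := boat o R (base₁ o m n R a b) (base₂ o m n R a b) (apex o m n R) r)
    (isCompact_triangle (base₁ o m n R a b) (base₂ o m n R a b) (apex o m n R))
    (l := r / (2 * R * a * (1 - a))) (by positivity) (by
      rintro x ⟨⟨y, hy, rfl⟩, -⟩
      refine ⟨y, hy, ?_⟩
      rw [hI, AffineMap.homothety_apply, vsub_eq_sub, vadd_eq_add, add_comm])
  rwa [hI, div_mul_cancel₀ _ hpos.ne'] at this

/-- An incenter is at distance at least `2 * R * (1 - a)` from the apex, so the scaling factor is at
most `1 / (2 * (1 - a))`. Multiplying by the inradius of the triangle gives the bound. -/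
lemma inradius_concentricBoat_le (h : IsBoatFrame m n R a b) {c : Plane}
    (hc : Metric.closedBall c
        (inradius (triangle (base₁ o m n R a b) (base₂ o m n R a b) (apex o m n R))) ⊆
      triangle (base₁ o m n R a b) (base₂ o m n R a b) (apex o m n R)) :
    inradius (concentricBoat o R (base₁ o m n R a b) (base₂ o m n R a b) (apex o m n R) c) ≤
      R * a := by
  have hR := h.R_pos
  have ha := h.a_pos
  have ha1 : 0 < 1 - a := by linarith [h.a_lt_one]
  have hI := h.inradius_triangle (o := o)
  have hpos : 0 < 2 * R * a * (1 - a) := by positivity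
  have h1 := (h.le_of_closedBall_subset_triangle (inradius_nonneg _) hc).1
  have h2 := neg_le_of_abs_le (abs_real_inner_le_norm m (c - apex o m n R))
  rw [h.norm_m, one_mul, ← dist_eq_norm, dist_comm] at h2
  rw [hI] at h1
  set d := dist (apex o m n R) c
  have h3 : 2 * R * a * (1 - a) ≤ a * d := by nlinarith
  have hd : 0 < d := by
    by_contra hd
    nlinarith
  have := inradius_le_of_subset_image (p := o) (q := c)
    (S := concentricBoat o R (base₁ o m n R a b) (base₂ o m n R a b) (apex o m n R) c)
    (isCompact_triangle (base₁ o m n R a b) (base₂ o m n R a b) (apex o m n R))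
    (l := R / d) (by positivity) Set.inter_subset_left
  rw [hI] at this
  refine this.trans ?_
  rw [div_mul_eq_mul_div, div_le_iff₀ hd]
  nlinarith

/-- The base has length `4 * R * a * b`, that is, 2R times the sine of the apex angle. Hence `C` is
at most the cosine `b ^ 2 - a ^ 2` of that angle, and `s ^ 2 * (1 - C) = 2` gives `s ≤ 1 / a`. -/
lemma boatFactor_le (h : IsBoatFrame m n R a b) {S : Set Plane} (hS : IsCompact S)
    (hSn : S.Nontrivial) (hball : S ⊆ Metric.closedBall o R) (h₁ : base₁ o m n R a b ∈ S)
    (h₂ : base₂ o m n R a b ∈ S) : boatFactor S * a ≤ 1 + a := by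
  have hR := h.R_pos
  have ha := h.a_pos
  have hb := h.b_pos
  have hab := h.sq_add_sq
  obtain ⟨s, C, hF, hs0, hsC, hC0, hC, hDC⟩ := exists_boatFactor_eq hS hSn
  have hD : 4 * R * a * b ≤ Metric.diam S := by
    refine le_trans ?_ (Metric.dist_le_diam_of_mem hS.isBounded h₁ h₂)
    rw [dist_eq_norm]
    have h1 := real_inner_le_norm n (base₁ o m n R a b - base₂ o m n R a b)
    rw [h.norm_n, one_mul, base₁, base₂, h.inner_n_framePt_sub] at h1
    rw [base₁, base₂]
    linarith
  have hRS := circumradius_le hR.le hball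
  have hRS0 := circumradius_pos hS hSn
  have h1 : (4 * R * a * b) ^ 2 ≤ 4 * (1 - C ^ 2) * R ^ 2 := by
    calc (4 * R * a * b) ^ 2 ≤ Metric.diam S ^ 2 := by gcongr
      _ = 4 * (1 - C ^ 2) * circumradius S ^ 2 := hDC
      _ ≤ 4 * (1 - C ^ 2) * R ^ 2 := by
        have : 0 ≤ 4 * (1 - C ^ 2) := by nlinarith
        gcongr
  have h2 : C ^ 2 ≤ (b ^ 2 - a ^ 2) ^ 2 := by
    have : 0 ≤ 4 * R ^ 2 * ((b ^ 2 - a ^ 2) ^ 2 - C ^ 2) := by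
      have e : (b ^ 2 - a ^ 2) ^ 2 = 1 - 4 * a ^ 2 * b ^ 2 := by
        linear_combination (a ^ 2 + b ^ 2 + 1) * hab
      rw [e]; nlinarith
    have := (mul_nonneg_iff_of_pos_left (by positivity)).1 this
    linarith
  have h3 : C ≤ b ^ 2 - a ^ 2 :=
    (abs_le_of_sq_le_sq' h2 (by nlinarith [h.le])).2
  have h4 : (s * a) ^ 2 ≤ 1 ^ 2 := by
    have : s ^ 2 * (2 * a ^ 2) ≤ s ^ 2 * (1 - C) := by
      gcongr
      linarith
    nlinarith
  have h5 := (abs_le_of_sq_le_sq' h4 zero_le_one).2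
  rw [hF]
  linarith

/-- A lower bound for the breadth of a set which is symmetric in the frame. -/
lemma le_breadth_of_mem {S : Set Plane} (hS : IsCompact S)
    {s₁ t₁ s₂ t₂ : ℝ} (h₁ : framePt o m n s₁ t₁ ∈ S) (h₁' : framePt o m n s₁ (-t₁) ∈ S)
    (h₂ : framePt o m n s₂ t₂ ∈ S) (h₂' : framePt o m n s₂ (-t₂) ∈ S) (u : Plane) :
    (s₁ - s₂) * |inner ℝ m u| + (t₁ - t₂) * |inner ℝ n u| ≤ breadth S u := by
  have key : ∀ s t s' t' : ℝ, framePt o m n s t ∈ S → framePt o m n s' t' ∈ S →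
      (s - s') * inner ℝ m u + (t - t') * inner ℝ n u ≤ breadth S u := by
    intro s t s' t' h1 h2
    have := inner_sub_inner_le_breadth hS h1 h2 u
    rw [← inner_sub_right, show framePt o m n s t - framePt o m n s' t' =
      (s - s') • m + (t - t') • n by simp only [framePt]; module, inner_add_right,
      inner_smul_right, inner_smul_right, real_inner_comm m u, real_inner_comm n u] at this
    exact this
  -- Reflection in the axis and exchange of the two points realize every choice of signs.
  rcases abs_cases (inner ℝ m u) with ⟨e1, -⟩ | ⟨e1, -⟩ <;>
    rcases abs_cases (inner ℝ n u) with ⟨e2, -⟩ | ⟨e2, -⟩ <;> rw [e1, e2]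
  · exact key _ _ _ _ h₁ h₂
  · linarith [key _ _ _ _ h₁' h₂']
  · linarith [key _ _ _ _ h₂' h₁']
  · linarith [key _ _ _ _ h₂ h₁]

lemma le_minWidth_boat (h : IsBoatFrame m n R a b) {r : ℝ} (hr : 2 * R * a * (1 - a) ≤ r)
    (hrR : r ≤ R * a) :
    r * (1 + a) ≤
      minWidth (boat o R (base₁ o m n R a b) (base₂ o m n R a b) (apex o m n R) r) * a := by
  have hR := h.R_pos
  have ha := h.a_pos
  have ha1 : 0 < 1 - a := by linarith [h.a_lt_one]
  have hab := h.sq_add_sq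
  have hr0 : 0 < r := lt_of_lt_of_le (by positivity) hr
  rw [← div_le_iff₀ ha]
  refine le_minWidth fun u hu => ?_
  set S := boat o R (base₁ o m n R a b) (base₂ o m n R a b) (apex o m n R) r with hS
  have hSc : IsCompact S := isCompact_boat _ _ _ _ _ _
  -- The rescaled triangle has height `r * (1 + a) / a = R * (1 + β)`, so its base is at level `-(R
  -- * β)`. The two bounds on `r` become `b ^ 2 - a ^ 2 ≤ β ≤ a`.
  obtain ⟨β, hβ⟩ : ∃ β, β = r * (1 + a) / (R * a) - 1 := ⟨_, rfl⟩
  have hrβ : r * (1 + a) = R * (1 + β) * a := by rw [hβ]; field_simp; ring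
  have hgoal : r * (1 + a) / a = (1 + β) * R := by rw [hrβ]; field_simp
  have hβa : β ≤ a := by
    have : R * a * (1 + β) ≤ R * a * (1 + a) := by nlinarith only [hrβ, hrR, ha]
    linarith [le_of_mul_le_mul_left this (by positivity)]
  have hβk : b ^ 2 - a ^ 2 ≤ β := by
    have : R * a * (1 + (b ^ 2 - a ^ 2)) ≤ R * a * (1 + β) := by
      have e : 1 + (b ^ 2 - a ^ 2) = 2 * (1 - a) * (1 + a) := by linear_combination hab
      rw [e]; nlinarith only [hrβ, hr, ha]
    linarith [le_of_mul_le_mul_left this (by positivity)]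
  have hmem : ∀ s t : ℝ, -β ≤ s → |t| * b ≤ (1 - s) * a → s ^ 2 + t ^ 2 ≤ 1 →
      framePt o m n (R * s) (R * t) ∈ S ∧ framePt o m n (R * s) (-(R * t)) ∈ S := by
    intro s t h1 h2 h3
    have g1 : R * a - r * (1 + a) ≤ R * s * a := by
      rw [hrβ]
      linarith [mul_le_mul_of_nonneg_left h1 (by positivity : 0 ≤ R * a)]
    have g2 : |R * t| * b ≤ (R - R * s) * a := by
      rw [abs_mul, abs_of_pos hR]
      linarith [mul_le_mul_of_nonneg_left h2 hR.le]
    have g3 : (R * s) ^ 2 + (R * t) ^ 2 ≤ R ^ 2 := by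
      linarith [mul_le_mul_of_nonneg_left h3 (by positivity : 0 ≤ R ^ 2)]
    exact ⟨h.framePt_mem_boat hr0 g1 g2 g3,
      h.framePt_mem_boat hr0 g1 (by rwa [abs_neg]) (by rwa [neg_sq])⟩
  have hXY := h.inner_sq_add_inner_sq u
  rw [hu, one_pow, ← sq_abs (inner ℝ m u), ← sq_abs (inner ℝ n u)] at hXY
  rw [hgoal, ← le_div_iff₀ hR]
  refine one_add_le_of_forall_breadth_le h.half_le h.le hab hβk hβa (abs_nonneg _) (abs_nonneg _)
    hXY fun s₁ t₁ s₂ t₂ h1 h2 h3 h4 h5 h6 => ?_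
  rw [le_div_iff₀ hR]
  have := le_breadth_of_mem hSc (hmem s₁ t₁ h1 h2 h3).1 (hmem s₁ t₁ h1 h2 h3).2
    (hmem s₂ t₂ h4 h5 h6).1 (hmem s₂ t₂ h4 h5 h6).2 u
  refine le_trans (le_of_eq ?_) this
  ring

theorem minWidth_boat (h : IsBoatFrame m n R a b) {r : ℝ} (hr : 2 * R * a * (1 - a) ≤ r)
    (hrR : r ≤ R * a) {S : Set Plane}
    (hS : S = boat o R (base₁ o m n R a b) (base₂ o m n R a b) (apex o m n R) r) :
    IsConvexBody S ∧ S.Nontrivial ∧ minWidth S = inradius S * boatFactor S := by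
  have hR := h.R_pos
  have ha := h.a_pos
  have hb := h.b_pos
  have hab := h.sq_add_sq
  have ha1 : 0 < 1 - a := by linarith [h.a_lt_one]
  have hr0 : 0 < r := lt_of_lt_of_le (by positivity) hr
  have hSc : IsCompact S := hS ▸ isCompact_boat _ _ _ _ _ _
  have hbase : ∀ t : ℝ, |t| = 2 * R * a * b →
      framePt o m n (-(R * (b ^ 2 - a ^ 2))) t ∈ S := by
    intro t ht
    rw [hS]
    refine h.framePt_mem_boat hr0 ?_ ?_ ?_
    · have : R * (1 + (b ^ 2 - a ^ 2)) * a ≤ r * (1 + a) := by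
        rw [show 1 + (b ^ 2 - a ^ 2) = 2 * (1 - a) * (1 + a) by linear_combination hab]
        nlinarith
      nlinarith
    · rw [ht]
      have : 1 + (b ^ 2 - a ^ 2) = 2 * b ^ 2 := by linear_combination -hab
      apply le_of_eq
      linear_combination (-R * a) * this
    · rw [← sq_abs t, ht]
      apply le_of_eq
      linear_combination (R ^ 2 * (a ^ 2 + b ^ 2 + 1)) * hab
  have h₁ : base₁ o m n R a b ∈ S := hbase _ (abs_of_pos (by positivity))
  have h₂ : base₂ o m n R a b ∈ S := hbase _ (by rw [abs_neg, abs_of_pos (by positivity)])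
  have hSn : S.Nontrivial := by
    refine ⟨_, h₁, _, h₂, fun heq => ?_⟩
    have := h.inner_n_framePt_sub (o := o) (-(R * (b ^ 2 - a ^ 2))) (2 * R * a * b)
      (-(R * (b ^ 2 - a ^ 2))) (-(2 * R * a * b))
    rw [← base₁, ← base₂, heq, sub_self, inner_zero_right] at this
    have : 0 < 2 * R * a * b := by positivity
    linarith
  have hSb : IsConvexBody S := ⟨hSc, hS ▸ convex_boat _ _ _ _ _ _, hSn.nonempty⟩
  refine ⟨hSb, hSn, le_antisymm (minWidth_le_inradius_mul_boatFactor hSb hSn) ?_⟩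
  have hF := h.boatFactor_le hSc hSn (hS ▸ Set.inter_subset_right) h₁ h₂
  have hI : inradius S ≤ r := hS ▸ h.inradius_boat_le hr0
  have hw : r * (1 + a) ≤ minWidth S * a := hS ▸ h.le_minWidth_boat hr hrR
  refine le_of_mul_le_mul_right ?_ ha
  calc inradius S * boatFactor S * a = inradius S * (boatFactor S * a) := by ring
    _ ≤ inradius S * (1 + a) := mul_le_mul_of_nonneg_left hF (inradius_nonneg S)
    _ ≤ r * (1 + a) := by gcongr
    _ ≤ minWidth S * a := hw

end IsBoatFrame

/-! ### From an isosceles triangle to its frame. -/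

/-- Every admissible isosceles triangle is described by a frame. -/
lemma IsBoatTriangle.exists_frame {o p₁ p₂ p₃ : Plane} {R : ℝ} (h : IsBoatTriangle o R p₁ p₂ p₃) :
    ∃ m n a b, IsBoatFrame m n R a b ∧ p₁ = IsBoatFrame.base₁ o m n R a b ∧
      p₂ = IsBoatFrame.base₂ o m n R a b ∧ p₃ = IsBoatFrame.apex o m n R := by
  have h12 : p₁ ≠ p₂ := h.affineIndependent.injective.ne (show (0 : Fin 3) ≠ 1 by decide)
  have n1 : ‖p₁ - o‖ = R := by rw [← dist_eq_norm]; exact h.mem_sphere₁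
  have n2 : ‖p₂ - o‖ = R := by rw [← dist_eq_norm]; exact h.mem_sphere₂
  have n3 : ‖p₃ - o‖ = R := by rw [← dist_eq_norm]; exact h.mem_sphere₃
  have hR : 0 < R := by
    rcases (n1 ▸ norm_nonneg (p₁ - o) : 0 ≤ R).eq_or_lt with h0 | h0
    · exfalso
      rw [← h0, norm_eq_zero, sub_eq_zero] at n1 n2
      exact h12 (n1.trans n2.symm)
    · exact h0
  set L := ‖p₁ - p₂‖ with hL
  have hL0 : 0 < L := norm_pos_iff.2 (sub_ne_zero.2 h12)
  set m := R⁻¹ • (p₃ - o) with hm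
  set n := L⁻¹ • (p₁ - p₂) with hn
  have hm1 : ‖m‖ = 1 := by
    rw [hm, norm_smul, n3, norm_inv, Real.norm_of_nonneg hR.le, inv_mul_cancel₀ hR.ne']
  have hn1 : ‖n‖ = 1 := by
    rw [hn, norm_smul, ← hL, norm_inv, Real.norm_of_nonneg hL0.le, inv_mul_cancel₀ hL0.ne']
  have e13 : ‖p₁ - p₃‖ ^ 2 = 2 * R ^ 2 - 2 * inner ℝ (p₁ - o) (p₃ - o) := by
    rw [← sub_sub_sub_cancel_right p₁ p₃ o, norm_sub_sq_real, n1, n3]; ring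
  have e23 : ‖p₂ - p₃‖ ^ 2 = 2 * R ^ 2 - 2 * inner ℝ (p₂ - o) (p₃ - o) := by
    rw [← sub_sub_sub_cancel_right p₂ p₃ o, norm_sub_sq_real, n2, n3]; ring
  have e12 : L ^ 2 = 2 * R ^ 2 - 2 * inner ℝ (p₁ - o) (p₂ - o) := by
    rw [hL, ← sub_sub_sub_cancel_right p₁ p₂ o, norm_sub_sq_real, n1, n2]; ring
  have hiso : ‖p₁ - p₃‖ = ‖p₂ - p₃‖ := by
    rw [← dist_eq_norm, ← dist_eq_norm]; exact h.isosceles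
  have hinn : inner ℝ (p₁ - o) (p₃ - o) = inner ℝ (p₂ - o) (p₃ - o) := by
    rw [hiso] at e13; linarith
  have hmn : inner ℝ m n = 0 := by
    rw [hm, hn, real_inner_smul_left, inner_smul_right, ← sub_sub_sub_cancel_right p₁ p₂ o,
      inner_sub_right, real_inner_comm (p₁ - o), real_inner_comm (p₂ - o), hinn, sub_self]
    ring
  -- The base is at level `-(R * k)` on the axis; `hcos` identifies `k` as the cosine of the apex
  -- angle.
  obtain ⟨k, hk⟩ : ∃ k, k = -inner ℝ m (p₁ - o) / R := ⟨_, rfl⟩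
  have hk1 : inner ℝ m (p₁ - o) = -(R * k) := by rw [hk]; field_simp
  have hk2 : inner ℝ m (p₂ - o) = -(R * k) := by
    rw [← hk1, hm, real_inner_smul_left, real_inner_smul_left, real_inner_comm (p₁ - o),
      real_inner_comm (p₂ - o), hinn]
  have hl1 : inner ℝ n (p₁ - o) = L / 2 := by
    rw [hn, real_inner_smul_left, ← sub_sub_sub_cancel_right p₁ p₂ o, inner_sub_left,
      real_inner_self_eq_norm_sq, n1, real_inner_comm (p₁ - o) (p₂ - o)]
    field_simp; linarith
  have hl2 : inner ℝ n (p₂ - o) = -(L / 2) := by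
    rw [hn, real_inner_smul_left, ← sub_sub_sub_cancel_right p₁ p₂ o, inner_sub_left,
      real_inner_self_eq_norm_sq, n2]
    field_simp; linarith
  have d1 := eq_inner_smul_add_inner_smul hm1 hn1 hmn (p₁ - o)
  have d2 := eq_inner_smul_add_inner_smul hm1 hn1 hmn (p₂ - o)
  rw [hk1, hl1] at d1
  rw [hk2, hl2] at d2
  have d3 : p₃ - o = R • m := by rw [hm, smul_inv_smul₀ hR.ne']
  have hi13 : inner ℝ (p₁ - o) (p₃ - o) = -(R ^ 2 * k) := by
    rw [d3, inner_smul_right, real_inner_comm, hk1]; ring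
  have hLk : L ^ 2 = 4 * R ^ 2 * (1 - k ^ 2) := by
    have h1 : ‖p₁ - o‖ ^ 2 = (R * k) ^ 2 + (L / 2) ^ 2 := by
      rw [d1, norm_add_sq_real, norm_smul (-(R * k)) m, norm_smul (L / 2) n, hm1, hn1, real_inner_smul_left,
        inner_smul_right, hmn, Real.norm_eq_abs, Real.norm_eq_abs, mul_one, mul_one, sq_abs,
        sq_abs]
      ring
    rw [n1] at h1
    linarith
  have hk3 : k ^ 2 < 1 := by
    by_contra hcon
    have : 0 < L ^ 2 := by positivity
    nlinarith [sq_pos_of_pos hR]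
  have hk4 : -1 < k := by nlinarith
  have hcos : Real.cos (EuclideanGeometry.angle p₁ p₃ p₂) = k := by
    have h1 := InnerProductGeometry.cos_angle_mul_norm_mul_norm (p₁ - p₃) (p₂ - p₃)
    rw [← hiso, ← sq, e13, hi13] at h1
    have h2 : inner ℝ (p₁ - p₃) (p₂ - p₃) = 2 * R ^ 2 * (1 + k) * k := by
      have := norm_sub_sq_real (p₁ - p₃) (p₂ - p₃)
      rw [sub_sub_sub_cancel_right, ← hL, ← hiso, e13, hi13, hLk] at this
      linarith
    rw [h2] at h1
    have h3 : 0 < 2 * R ^ 2 * (1 + k) := by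
      have : 0 < 1 + k := by linarith
      positivity
    have h4 : 2 * R ^ 2 - 2 * -(R ^ 2 * k) = 2 * R ^ 2 * (1 + k) := by ring
    rw [h4, mul_comm] at h1
    exact mul_left_cancel₀ h3.ne' h1
  have hkhalf : k ≤ 1 / 2 := by
    rw [← hcos, ← Real.cos_pi_div_three]
    exact Real.cos_le_cos_of_nonneg_of_le_pi (by positivity)
      (h.angle_le.trans (by linarith [Real.pi_pos])) h.le_angle
  have hk0 : 0 ≤ k := by
    rw [← hcos]
    exact Real.cos_nonneg_of_neg_pi_div_two_le_of_le
      (by linarith [Real.pi_pos, h.le_angle]) h.angle_le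
  -- Half-angle formulas: the roots are the sine and cosine of half the apex angle.
  have ha2 := Real.sq_sqrt (show 0 ≤ (1 - k) / 2 by linarith)
  have hb2 := Real.sq_sqrt (show 0 ≤ (1 + k) / 2 by linarith)
  have ha0 := Real.sqrt_nonneg ((1 - k) / 2)
  have hb0 := Real.sqrt_nonneg ((1 + k) / 2)
  have hle : √((1 - k) / 2) ≤ √((1 + k) / 2) := Real.sqrt_le_sqrt (by linarith)
  set a := √((1 - k) / 2)
  set b := √((1 + k) / 2)
  have hkab : k = b ^ 2 - a ^ 2 := by rw [ha2, hb2]; ring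
  have hLab : L / 2 = 2 * R * a * b := by
    have h1 : (L / 2) ^ 2 = (2 * R * a * b) ^ 2 := by
      rw [mul_pow, mul_pow, mul_pow, ha2, hb2, div_pow, hLk]; ring
    exact (sq_eq_sq₀ (by positivity) (by positivity)).1 h1
  refine ⟨m, n, a, b, ⟨hm1, hn1, hmn, hR, by nlinarith, hle, by rw [ha2, hb2]; ring⟩, ?_, ?_, ?_⟩
  · rw [IsBoatFrame.base₁, framePt, ← hkab, ← hLab, add_assoc, ← d1]; abel
  · rw [IsBoatFrame.base₂, framePt, ← hkab, ← hLab, add_assoc, ← d2]; abel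
  · rw [IsBoatFrame.apex, framePt, ← d3]; simp

end

theorem mainTheorem2 :
    (∀ K : Set Plane, IsConvexBody K → K.Nontrivial →
      minWidth K ≤ inradius K * boatFactor K ∧
      boatFactor K ≤ 3 ∧
      minWidth K ≤ 3 * inradius K) ∧
    (∀ S : Set Plane, IsSailingBoat S →
      IsConvexBody S ∧ S.Nontrivial ∧
      minWidth S = inradius S * boatFactor S) := by
  refine ⟨fun K hK hn => ?_, ?_⟩
  · have h1 := minWidth_le_inradius_mul_boatFactor hK hn
    have h2 := boatFactor_le_three hK.isCompact hn
    refine ⟨h1, h2, h1.trans ?_⟩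
    rw [mul_comm]
    exact mul_le_mul_of_nonneg_right h2 (inradius_nonneg K)
  · rintro S ⟨o, R, p₁, p₂, p₃, c, r, hT, hc, hr, hrc, hS⟩
    obtain ⟨m, n, a, b, hF, rfl, rfl, rfl⟩ := hT.exists_frame
    refine hF.minWidth_boat ?_ (hrc.trans (hF.inradius_concentricBoat_le hc)) hS
    rwa [hF.inradius_triangle] at hr
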